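/- **Setting.** Let $d\ge 2$ and let $\Gamma=(V,\mathcal E)$ be an infinite connected graph, possibly with loops and multiple edges. Each unoriented edge gives two oppositely oriented edges, and $\mathcal A$ denotes the set of oriented edges. The degree $\varkappa_v$ is the number of edges in $\mathcal A$ starting at $v$. Assume that $\Gamma$ is $\mathbb Z^d$-periodic: $\mathbb Z^d$ acts on $\Gamma$ by graph automorphisms, freely on $V$, all degrees are finite, and the quotient graph $\Gamma_*=\Gamma/\mathbb Z^d$, with vertex set $V_*$ and oriented edge set $\mathcal A_*$, is finite. Let $Q:V\to\mathbb R$ satisfy $Q(v+m)=Q(v)$ for all $v\in V$, $m\in\mathbb Z^d$, and let $H=\Delta+Q$ on $\ell^2(V)$, where $$(\Delta f)(v)=f(v)-\sum_{(v,u)\in\mathcal A}\frac{f(u)}{\sqrt{\varkappa_v\varkappa_u}} .$$ Fix a set $V_0\subset V$ containing exactly one vertex of each $\mathbb Z^d$-orbit, and write $v=v_0+[v]$ with $v_0\in V_0$, $[v]\in\mathbb Z^d$. The index of an edge $\mathbf e=(u,v)\in\mathcal A$ is $\tau(\mathbf e)=[v]-[u]$; it depends only on the class of $\mathbf e$ in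 $\mathcal A_*$. For $\vartheta\in\mathbb T^d=\mathbb R^d/(2\pi\mathbb Z)^d$ the fiber operators on $\ell^2(V_*)$ are $H(\vartheta)=\Delta(\vartheta)+Q$ and $$(\Delta(\vartheta)f)(v)=f(v)-\sum_{\mathbf e=(v,u)\in\mathcal A_*}\frac{e^{i\langle\tau(\mathbf e),\vartheta\rangle}}{\sqrt{\varkappa_v\varkappa_u}}\,f(u),\qquad v\in V_* .$$ Let $\lambda_1(\vartheta)$ be the lowest eigenvalue of $H(\vartheta)$. The first spectral band of $H$ is $\sigma_1(H)=[\lambda_1^-,\lambda_1^+]=\lambda_1(\mathbb T^d)$, and $|\cdot|$ denotes Lebesgue measure. Let $M=\big(\partial^2\lambda_1(0)/\partial\vartheta_i\partial\vartheta_j\big)_{i,j=1}^d$. The effective mass tensor of $H$ at the bottom of the spectrum is $m=M^{-1}$. Let $\sigma_1(\Delta)$ and $m_0$ be the corresponding objects for $Q=0$. **Theorem.** i) The lowest eigenvalue $\lambda_1(0)$ of $H(0)$ is simple and has an eigenvector $\psi\in\ell^2(V_*)$ with positive components. ii) The first spectral band $\sigma_1(H)=[\lambda_1^-,\lambda_1^+]$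 is non-degenerate, i.e. $\lambda_1^-<\lambda_1^+$, and $$c_0^{-2}\,|\sigma_1(\Delta)|\le|\sigma_1(H)|\le c_0^{2}\,|\sigma_1(\Delta)|,\qquad c_0=\frac{\psi_+}{\psi_-},\quad \psi_-=\min_{v\in V_*}\frac{\psi(v)}{\sqrt{\varkappa_v}},\quad \psi_+=\max_{v\in V_*}\frac{\psi(v)}{\sqrt{\varkappa_v}} .$$ iii) The function $\lambda_1$ is three times continuously differentiable near $\vartheta=0$ and $M$ is invertible, both for $H$ and for $\Delta$, and the effective mass tensors satisfy $$c_0^{-2}\,m_0\le m\le c_0^{2}\,m_0$$ in the sense of quadratic forms. -/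

import Mathlib

noncomputable section

/-- A connected, locally finite, `ℤ^d`-periodic graph, possibly with loops and multiple edges.
`V` is the set of vertices and `A` the set of oriented edges: an unoriented edge (in particular a
loop) is a pair `{e, rev e}` of two distinct, mutually opposite oriented edges. The group `ℤ^d`
acts by graph automorphisms, freely on the vertices, with finite quotient graph. -/
structure PeriodicGraph (d : ℕ) (V A : Type*)
    [AddAction (Fin d → ℤ) V] [AddAction (Fin d → ℤ) A] where
  /-- the initial vertex of an oriented edge -/
  src : A → V
  /-- the terminal vertex of an oriented edge -/
  tgt : A → V
  /-- the opposite oriented edge -/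
  rev : A → A
  rev_rev : ∀ e, rev (rev e) = e
  rev_ne : ∀ e, rev e ≠ e
  src_rev : ∀ e, src (rev e) = tgt e
  src_vadd : ∀ (m : Fin d → ℤ) (e : A), src (m +ᵥ e) = m +ᵥ src e
  tgt_vadd : ∀ (m : Fin d → ℤ) (e : A), tgt (m +ᵥ e) = m +ᵥ tgt e
  rev_vadd : ∀ (m : Fin d → ℤ) (e : A), rev (m +ᵥ e) = m +ᵥ rev e
  free : ∀ (m : Fin d → ℤ) (v : V), m +ᵥ v = v → m = 0
  nonempty : Nonempty V
  connected : ∀ u v : V, Relation.ReflTransGen (fun a b => ∃ e, src e = a ∧ tgt e = b) u v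
  locallyFinite : ∀ v : V, {e : A | src e = v}.Finite
  finite_vertices : Finite (AddAction.orbitRel.Quotient (Fin d → ℤ) V)
  finite_edges : Finite (AddAction.orbitRel.Quotient (Fin d → ℤ) A)

namespace PeriodicGraph

variable {d : ℕ} {V A : Type*} [AddAction (Fin d → ℤ) V] [AddAction (Fin d → ℤ) A]

/-! ### The graph, its Laplacian and Schrödinger operator -/

/-- The set of oriented edges starting at `v`. -/
def star (G : PeriodicGraph d V A) (v : V) : Finset A := (G.locallyFinite v).toFinset

theorem mem_star (G : PeriodicGraph d V A) {v : V} {e : A} : e ∈ G.star v ↔ G.src e = v := by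
  simp [star]

/-- The degree `κ_v`: the number of oriented edges starting at `v` (a loop counts twice). -/
def degree (G : PeriodicGraph d V A) (v : V) : ℕ := (G.star v).card

theorem degree_vadd (G : PeriodicGraph d V A) (m : Fin d → ℤ) (v : V) :
    G.degree (m +ᵥ v) = G.degree v := by
  unfold degree
  refine (Finset.card_bij (fun e _ => m +ᵥ e) ?_ ?_ ?_).symm
  · intro e he
    rw [mem_star] at he ⊢
    rw [G.src_vadd, he]
  · intro a _ b _ h
    exact AddAction.injective m h
  · intro e he
    rw [mem_star] at he
    refine ⟨-m +ᵥ e, ?_, ?_⟩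
    · rw [mem_star, G.src_vadd, he, neg_vadd_vadd]
    · rw [vadd_neg_vadd]

/-- A real `ℤ^d`-periodic potential on the vertices. -/
structure Potential (_G : PeriodicGraph d V A) where
  /-- the values of the potential -/
  toFun : V → ℝ
  periodic : ∀ (m : Fin d → ℤ) (v : V), toFun (m +ᵥ v) = toFun v

/-- The zero potential. -/
def Potential.zero (G : PeriodicGraph d V A) : G.Potential := ⟨fun _ => 0, fun _ _ => rfl⟩

/-- The normalized Laplacian `(Δ f)(v) = f(v) - ∑_{(v,u) ∈ A} f(u) / √(κ_v κ_u)`. -/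
def laplacian (G : PeriodicGraph d V A) (f : V → ℂ) (v : V) : ℂ :=
  f v - ∑ e ∈ G.star v,
    f (G.tgt e) / (Real.sqrt ((G.degree v : ℝ) * (G.degree (G.tgt e) : ℝ)) : ℂ)

/-- The Schrödinger operator `H = Δ + Q`. -/
def schrodinger (G : PeriodicGraph d V A) (Q : G.Potential) (f : V → ℂ) (v : V) : ℂ :=
  G.laplacian f v + (Q.toFun v : ℂ) * f v

/-! ### The fundamental (quotient) graph -/

/-- The vertices `V_* = V / ℤ^d` of the fundamental graph. -/
def QVertex (_G : PeriodicGraph d V A) : Type _ := AddAction.orbitRel.Quotient (Fin d → ℤ) V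

/-- The oriented edges `A_* = A / ℤ^d` of the fundamental graph. -/
def QEdge (_G : PeriodicGraph d V A) : Type _ := AddAction.orbitRel.Quotient (Fin d → ℤ) A

instance (G : PeriodicGraph d V A) : Finite G.QVertex := G.finite_vertices

instance (G : PeriodicGraph d V A) : Finite G.QEdge := G.finite_edges

instance (G : PeriodicGraph d V A) : Fintype G.QVertex := Fintype.ofFinite _

instance (G : PeriodicGraph d V A) : Fintype G.QEdge := Fintype.ofFinite _

/-- The class of a vertex. -/
def mkV (G : PeriodicGraph d V A) (v : V) : G.QVertex :=
  Quotient.mk (AddAction.orbitRel (Fin d → ℤ) V) v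

/-- The class of an oriented edge. -/
def mkE (G : PeriodicGraph d V A) (e : A) : G.QEdge :=
  Quotient.mk (AddAction.orbitRel (Fin d → ℤ) A) e

instance (G : PeriodicGraph d V A) : Nonempty G.QVertex := G.nonempty.map G.mkV

theorem mkV_eq (G : PeriodicGraph d V A) {u v : V} :
    G.mkV u = G.mkV v ↔ ∃ m : Fin d → ℤ, m +ᵥ v = u := by
  exact Quotient.eq.trans (AddAction.orbitRel_apply.trans AddAction.mem_orbit_iff)

theorem mkE_eq (G : PeriodicGraph d V A) {a b : A} :
    G.mkE a = G.mkE b ↔ ∃ m : Fin d → ℤ, m +ᵥ b = a := by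
  exact Quotient.eq.trans (AddAction.orbitRel_apply.trans AddAction.mem_orbit_iff)

/-- A `ℤ^d`-invariant function on vertices, as a function on `V_*`. -/
def descendV {β : Type*} (G : PeriodicGraph d V A) (F : V → β)
    (hF : ∀ (m : Fin d → ℤ) (v : V), F (m +ᵥ v) = F v) : G.QVertex → β :=
  Quotient.lift F (by
    intro a b h
    obtain ⟨m, rfl⟩ := AddAction.mem_orbit_iff.1 (AddAction.orbitRel_apply.1 h)
    exact hF m b)

/-- A `ℤ^d`-invariant function on oriented edges, as a function on `A_*`. -/
def descendE {β : Type*} (G : PeriodicGraph d V A) (F : A → β)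
    (hF : ∀ (m : Fin d → ℤ) (e : A), F (m +ᵥ e) = F e) : G.QEdge → β :=
  Quotient.lift F (by
    intro a b h
    obtain ⟨m, rfl⟩ := AddAction.mem_orbit_iff.1 (AddAction.orbitRel_apply.1 h)
    exact hF m b)

/-- The initial vertex of an oriented edge of the fundamental graph. -/
def qsrc (G : PeriodicGraph d V A) : G.QEdge → G.QVertex :=
  G.descendE (fun e => G.mkV (G.src e)) (fun m e => G.mkV_eq.2 ⟨m, (G.src_vadd m e).symm⟩)

/-- The terminal vertex of an oriented edge of the fundamental graph. -/
def qtgt (G : PeriodicGraph d V A) : G.QEdge → G.QVertex :=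
  G.descendE (fun e => G.mkV (G.tgt e)) (fun m e => G.mkV_eq.2 ⟨m, (G.tgt_vadd m e).symm⟩)

/-- The degree `κ_v` as a function of `v ∈ V_*`. -/
def qdegree (G : PeriodicGraph d V A) : G.QVertex → ℕ := G.descendV G.degree G.degree_vadd

/-- The potential as a function on `V_*`. -/
def Potential.onQuotient {G : PeriodicGraph d V A} (Q : G.Potential) : G.QVertex → ℝ :=
  G.descendV Q.toFun Q.periodic

/-! ### Coordinates of vertices and indices of edges -/

/-- A fundamental vertex set `V₀ ⊆ V`, given as the choice of one vertex in each class. -/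
structure FundamentalSet (G : PeriodicGraph d V A) where
  /-- the vertex of `V₀` in a given class -/
  rep : G.QVertex → V
  mkV_rep : ∀ x, G.mkV (rep x) = x

variable {G : PeriodicGraph d V A}

theorem FundamentalSet.exists_coord (S : G.FundamentalSet) (v : V) :
    ∃ m : Fin d → ℤ, m +ᵥ S.rep (G.mkV v) = v :=
  G.mkV_eq.1 (S.mkV_rep (G.mkV v)).symm

/-- The coordinates `[v] ∈ ℤ^d` of `v` with respect to `V₀`: `v = v₀ + [v]` with `v₀ ∈ V₀`. -/
def FundamentalSet.coord (S : G.FundamentalSet) (v : V) : Fin d → ℤ :=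
  Classical.choose (S.exists_coord v)

theorem FundamentalSet.coord_vadd_rep (S : G.FundamentalSet) (v : V) :
    S.coord v +ᵥ S.rep (G.mkV v) = v :=
  Classical.choose_spec (S.exists_coord v)

theorem FundamentalSet.coord_vadd (S : G.FundamentalSet) (m : Fin d → ℤ) (v : V) :
    S.coord (m +ᵥ v) = m + S.coord v := by
  have h1 := S.coord_vadd_rep (m +ᵥ v)
  have h2 : G.mkV (m +ᵥ v) = G.mkV v := G.mkV_eq.2 ⟨m, rfl⟩
  rw [h2] at h1
  have h3 : (m + S.coord v) +ᵥ S.rep (G.mkV v) = m +ᵥ v := by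
    rw [add_vadd, S.coord_vadd_rep]
  have h4 := G.free (-(m + S.coord v) + S.coord (m +ᵥ v)) (S.rep (G.mkV v)) (by
    rw [add_vadd, h1, ← h3, neg_vadd_vadd])
  exact (neg_add_eq_zero.1 h4).symm

/-- The index `τ(e) = [v] - [u]` of an oriented edge `e = (u, v)` of the periodic graph. -/
def FundamentalSet.index (S : G.FundamentalSet) (e : A) : Fin d → ℤ :=
  S.coord (G.tgt e) - S.coord (G.src e)

theorem FundamentalSet.index_vadd (S : G.FundamentalSet) (m : Fin d → ℤ) (e : A) :
    S.index (m +ᵥ e) = S.index e := by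
  unfold FundamentalSet.index
  rw [G.tgt_vadd, G.src_vadd, S.coord_vadd, S.coord_vadd, add_sub_add_left_eq_sub]

/-- The index `τ(e)` of an oriented edge of the fundamental graph. -/
def FundamentalSet.qindex (S : G.FundamentalSet) : G.QEdge → (Fin d → ℤ) :=
  G.descendE S.index S.index_vadd

/-- The pairing `⟨n, θ⟩` of `n ∈ ℤ^d` and `θ ∈ ℝ^d`. -/
def pairing (n : Fin d → ℤ) (θ : Fin d → ℝ) : ℝ := ∑ i, (n i : ℝ) * θ i

/-! ### Fiber operators -/

open Classical in
/-- The fiber Laplacian on `ℓ²(V_*)`: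
`(Δ(θ) f)(v) = f(v) - ∑_{e = (v,u) ∈ A_*} e^{i⟨τ(e), θ⟩} f(u) / √(κ_v κ_u)`. -/
def FundamentalSet.fiberLaplacian (S : G.FundamentalSet) (θ : Fin d → ℝ) :
    Module.End ℂ (G.QVertex → ℂ) where
  toFun f v := f v - ∑ e : G.QEdge with G.qsrc e = v,
    Complex.exp (Complex.I * (pairing (S.qindex e) θ : ℂ)) /
      (Real.sqrt ((G.qdegree v : ℝ) * (G.qdegree (G.qtgt e) : ℝ)) : ℂ) * f (G.qtgt e)
  map_add' f g := by
    funext v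
    simp only [Pi.add_apply, mul_add, Finset.sum_add_distrib]
    ring
  map_smul' c f := by
    funext v
    simp only [Pi.smul_apply, smul_eq_mul, RingHom.id_apply, mul_sub, Finset.mul_sum]
    congr 1
    exact Finset.sum_congr rfl fun e _ => by ring

/-- The fiber Schrödinger operator `H(θ) = Δ(θ) + Q` on `ℓ²(V_*)`. -/
def FundamentalSet.fiber (S : G.FundamentalSet) (Q : G.Potential) (θ : Fin d → ℝ) :
    Module.End ℂ (G.QVertex → ℂ) :=
  S.fiberLaplacian θ + LinearMap.pi fun v => (Q.onQuotient v : ℂ) • LinearMap.proj v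

/-- The Floquet extension of `g ∈ ℓ²(V_*)`, that is the function on `V` which satisfies
`f(v + m) = e^{i⟨m, θ⟩} f(v)` and coincides with `g` on `V₀`. -/
def FundamentalSet.extend (S : G.FundamentalSet) (θ : Fin d → ℝ) (g : G.QVertex → ℂ) (v : V) : ℂ :=
  Complex.exp (Complex.I * (pairing (S.coord v) θ : ℂ)) * g (G.mkV v)

/-- `H(θ)` is the action of `H` on the functions of quasi-momentum `θ`. -/
theorem FundamentalSet.schrodinger_extend (S : G.FundamentalSet) (Q : G.Potential)
    (θ : Fin d → ℝ) (g : G.QVertex → ℂ) (v : V) :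
    G.schrodinger Q (S.extend θ g) v = S.extend θ (S.fiber Q θ g) v := by
  classical
  have hsum : ∑ e ∈ G.star v, S.extend θ g (G.tgt e) /
        (Real.sqrt ((G.degree v : ℝ) * (G.degree (G.tgt e) : ℝ)) : ℂ) =
      Complex.exp (Complex.I * (pairing (S.coord v) θ : ℂ)) *
        ∑ e : G.QEdge with G.qsrc e = G.mkV v,
          Complex.exp (Complex.I * (pairing (S.qindex e) θ : ℂ)) /
          (Real.sqrt ((G.qdegree (G.mkV v) : ℝ) * (G.qdegree (G.qtgt e) : ℝ)) : ℂ) *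
            g (G.qtgt e) := by
    rw [Finset.mul_sum]
    refine Finset.sum_bij (fun e _ => G.mkE e) ?_ ?_ ?_ ?_
    · intro e he
      rw [mem_star] at he
      rw [Finset.mem_filter]
      exact ⟨Finset.mem_univ _, congrArg G.mkV he⟩
    · intro a ha b hb h
      rw [mem_star] at ha hb
      obtain ⟨m, rfl⟩ := G.mkE_eq.1 h
      have : m = 0 := G.free m v (by rw [← hb, ← G.src_vadd, ha, hb])
      rw [this, zero_vadd]
    · intro x hx
      obtain ⟨e, rfl⟩ := Quotient.exists_rep x
      have h1 : G.mkV (G.src e) = G.mkV v := (Finset.mem_filter.1 hx).2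
      obtain ⟨m, hm⟩ := G.mkV_eq.1 h1
      refine ⟨-m +ᵥ e, ?_, ?_⟩
      · rw [mem_star, G.src_vadd, ← hm, neg_vadd_vadd]
      · exact G.mkE_eq.2 ⟨-m, rfl⟩
    · intro e he
      rw [mem_star] at he
      have h1 : S.qindex (G.mkE e) = S.coord (G.tgt e) - S.coord v := by
        rw [← he]; rfl
      have h2 : (pairing (S.coord (G.tgt e)) θ : ℂ) =
          (pairing (S.coord v) θ : ℂ) + (pairing (S.coord (G.tgt e) - S.coord v) θ : ℂ) := by
        rw [← Complex.ofReal_add]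
        congr 1
        simp only [pairing, ← Finset.sum_add_distrib]
        exact Finset.sum_congr rfl fun i _ => by simp only [Pi.sub_apply]; push_cast; ring
      have h3 : G.qtgt (G.mkE e) = G.mkV (G.tgt e) := rfl
      have h4 : G.qdegree (G.mkV v) = G.degree v := rfl
      have h5 : G.qdegree (G.mkV (G.tgt e)) = G.degree (G.tgt e) := rfl
      rw [h1, h3, h4, h5, FundamentalSet.extend, h2, mul_add, Complex.exp_add]
      ring
  have hQ : Q.onQuotient (G.mkV v) = Q.toFun v := rfl
  have hfib : S.fiber Q θ g (G.mkV v) = (g (G.mkV v) -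
      ∑ e : G.QEdge with G.qsrc e = G.mkV v,
          Complex.exp (Complex.I * (pairing (S.qindex e) θ : ℂ)) /
          (Real.sqrt ((G.qdegree (G.mkV v) : ℝ) * (G.qdegree (G.qtgt e) : ℝ)) : ℂ) *
            g (G.qtgt e)) + (Q.toFun v : ℂ) * g (G.mkV v) := by
    rw [← hQ]
    simp only [FundamentalSet.fiber, FundamentalSet.fiberLaplacian, LinearMap.add_apply,
      Pi.add_apply, LinearMap.coe_mk, AddHom.coe_mk, LinearMap.pi_apply, LinearMap.smul_apply,
      LinearMap.proj_apply, smul_eq_mul]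
  rw [schrodinger, laplacian, hsum, FundamentalSet.extend, FundamentalSet.extend, hfib]
  ring

/-! ### The first band and the effective mass tensor -/

/-- The set of (real) eigenvalues of the self-adjoint operator `H(θ)`. -/
def FundamentalSet.eigenvalues (S : G.FundamentalSet) (Q : G.Potential) (θ : Fin d → ℝ) : Set ℝ :=
  {t | (S.fiber Q θ).HasEigenvalue (t : ℂ)}

/-- The first band function: `λ₁(θ)` is the lowest eigenvalue of `H(θ)`. -/
def FundamentalSet.lowest (S : G.FundamentalSet) (Q : G.Potential) (θ : Fin d → ℝ) : ℝ :=
  sInf (S.eigenvalues Q θ)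

/-- The first spectral band `σ₁(H) = λ₁(𝕋^d)`. -/
def FundamentalSet.firstBand (S : G.FundamentalSet) (Q : G.Potential) : Set ℝ :=
  Set.range (S.lowest Q)

/-- The length (Lebesgue measure) `|σ₁(H)|` of the first spectral band. -/
def FundamentalSet.firstBandLength (S : G.FundamentalSet) (Q : G.Potential) : ℝ :=
  MeasureTheory.volume.real (S.firstBand Q)

/-- The matrix `M_{ij} = ∂²λ₁(0) / ∂θ_i ∂θ_j`. -/
def FundamentalSet.massHessian (S : G.FundamentalSet) (Q : G.Potential) :
    Matrix (Fin d) (Fin d) ℝ :=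
  Matrix.of fun i j =>
    fderiv ℝ (fun θ => fderiv ℝ (S.lowest Q) θ (Pi.single j 1)) 0 (Pi.single i 1)

/-- The effective mass tensor `m = M⁻¹` at the bottom of the spectrum. -/
def FundamentalSet.effectiveMass (S : G.FundamentalSet) (Q : G.Potential) :
    Matrix (Fin d) (Fin d) ℝ :=
  (S.massHessian Q)⁻¹

/-- `ψ` is an eigenvector of `H(0)` for `λ₁(0)` with positive components. -/
def FundamentalSet.IsPositiveGroundState (S : G.FundamentalSet) (Q : G.Potential)
    (ψ : G.QVertex → ℝ) : Prop :=
  (∀ v, 0 < ψ v) ∧ (S.fiber Q 0).HasEigenvector (S.lowest Q 0 : ℂ) (fun v => (ψ v : ℂ))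

/-- `ψ₋ = min_v ψ(v) / √κ_v`. -/
def psiMinus (G : PeriodicGraph d V A) (ψ : G.QVertex → ℝ) : ℝ :=
  ⨅ v, ψ v / Real.sqrt (G.qdegree v)

/-- `ψ₊ = max_v ψ(v) / √κ_v`. -/
def psiPlus (G : PeriodicGraph d V A) (ψ : G.QVertex → ℝ) : ℝ :=
  ⨆ v, ψ v / Real.sqrt (G.qdegree v)

/-- `c₀ = ψ₊ / ψ₋`. -/
def cZero (G : PeriodicGraph d V A) (ψ : G.QVertex → ℝ) : ℝ := G.psiPlus ψ / G.psiMinus ψ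

end PeriodicGraph

end

/-!
Write `μ = λ₁(0)` and let `ψ > 0` be the ground state of `H(0)`. The substitution `x = ψ g` turns
the quadratic form of `H(θ) - μ` into the energy
`½ ∑_{e = (u, v)} ψ(u) ψ(v) |g(u) - e^{i⟨τ(e), θ⟩} g(v)|² / √(κ_u κ_v)`, in which the potential
appears only through `ψ`. The ground state of `Δ(0)` is `√κ`, and `ψ₋ √κ ≤ ψ ≤ ψ₊ √κ`;
comparing the two energies and the two norms gives
`c₀⁻² (λ₁⁰(θ) - λ₁⁰(0)) ≤ λ₁(θ) - λ₁(0) ≤ c₀² (λ₁⁰(θ) - λ₁⁰(0))` for all `θ`, where `λ₁⁰` belongs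
to `Δ`. The band lengths inherit this comparison, and so do the Hessians at the common minimum
`θ = 0`; inversion reverses the order between the latter.

For the non-degeneracy, extend `g` to `Γ` with phases `e^{i⟨[v], θ⟩}`: the differences along a path
from `v` to `v + m` are controlled by the energy, and their sum is `(e^{i⟨m, θ⟩} - 1)` times the
value at `v`, so that `λ₁(θ) - λ₁(0) ≥ c (1 - cos⟨m, θ⟩)`. Near `θ = 0` the function `λ₁` is smooth
by the implicit function theorem, as a simple root of the characteristic polynomial.
-/

noncomputable section

section LowestEigenvalue

open Matrix Module.End Filter Topology
open scoped ContDiff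

variable {𝕜 n : Type*} [RCLike 𝕜] [Fintype n] [DecidableEq n]

/-- The lowest real eigenvalue of a square matrix. It is meaningful for Hermitian matrices; the
infimum is `0` by convention if there is no real eigenvalue. -/
def lowestEigenvalue (A : Matrix n n 𝕜) : ℝ := sInf (spectrum ℝ A)

theorem mem_spectrum_real_iff_exists_mulVec {A : Matrix n n 𝕜} {t : ℝ} :
    t ∈ spectrum ℝ A ↔ ∃ x ≠ 0, A *ᵥ x = t • x := by
  rw [← spectrum.algebraMap_mem_iff 𝕜, ← spectrum_toLin', ← hasEigenvalue_iff_mem_spectrum]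
  constructor
  · intro h
    obtain ⟨x, hx⟩ := h.exists_hasEigenvector
    exact ⟨x, hx.2, by simpa using hx.apply_eq_smul⟩
  · rintro ⟨x, hx, h⟩
    exact hasEigenvalue_of_hasEigenvector
      (hasEigenvector_iff.2 ⟨mem_eigenspace_iff.2 (by simpa using h), hx⟩)

theorem sum_norm_sq_pos {ι E : Type*} [Fintype ι] [NormedAddCommGroup E] {x : ι → E} (hx : x ≠ 0) :
    0 < ∑ i, ‖x i‖ ^ 2 := by
  obtain ⟨i, hi⟩ := Function.ne_iff.1 hx
  exact Finset.sum_pos' (fun _ _ => by positivity) ⟨i, Finset.mem_univ i,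
    pow_pos (norm_pos_iff.2 hi) 2⟩

theorem sum_norm_smul_sq_pos {ι E : Type*} [Fintype ι] [NormedAddCommGroup E] [NormedSpace ℝ E]
    {c : ι → ℝ} (hc : ∀ i, c i ≠ 0) {x : ι → E} (hx : x ≠ 0) : 0 < ∑ i, ‖c i • x i‖ ^ 2 := by
  obtain ⟨i, hi⟩ := Function.ne_iff.1 hx
  exact sum_norm_sq_pos (Function.ne_iff.2 ⟨i, smul_ne_zero (hc i) hi⟩)

omit [DecidableEq n] in
theorem abs_re_star_dotProduct_mulVec_le (A : Matrix n n 𝕜) (x : n → 𝕜) :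
    |RCLike.re (star x ⬝ᵥ A *ᵥ x)| ≤ (∑ i, ∑ j, ‖A i j‖) * ∑ i, ‖x i‖ ^ 2 := by
  set N := ∑ i, ‖x i‖ ^ 2
  have hsq (i : n) : ‖x i‖ ^ 2 ≤ N :=
    Finset.single_le_sum (f := fun k => ‖x k‖ ^ 2) (fun _ _ => by positivity) (Finset.mem_univ i)
  refine (RCLike.abs_re_le_norm _).trans ?_
  simp only [dotProduct, mulVec, Finset.sum_mul, Pi.star_apply]
  refine norm_sum_le_of_le _ fun i _ => ?_
  rw [Finset.mul_sum]
  refine norm_sum_le_of_le _ fun j _ => ?_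
  rw [norm_mul, norm_mul, norm_star]
  calc ‖x i‖ * (‖A i j‖ * ‖x j‖) = ‖A i j‖ * (‖x i‖ * ‖x j‖) := by ring
    _ ≤ ‖A i j‖ * N := by
      gcongr
      nlinarith [sq_nonneg (‖x i‖ - ‖x j‖), hsq i, hsq j]

omit [DecidableEq n] in
theorem star_dotProduct_self_eq_sum_norm_sq (x : n → 𝕜) :
    star x ⬝ᵥ x = ((∑ i, ‖x i‖ ^ 2 : ℝ) : 𝕜) := by
  simp [dotProduct, RCLike.conj_mul]

omit [DecidableEq n] in
theorem re_star_dotProduct_of_mulVec_eq {A : Matrix n n 𝕜} {t : ℝ} {x : n → 𝕜}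
    (h : A *ᵥ x = t • x) : RCLike.re (star x ⬝ᵥ A *ᵥ x) = t * ∑ i, ‖x i‖ ^ 2 := by
  rw [h, dotProduct_smul, star_dotProduct_self_eq_sum_norm_sq, RCLike.smul_re, RCLike.ofReal_re]

theorem sub_algebraMap_mulVec (A : Matrix n n 𝕜) (t : ℝ) (x : n → 𝕜) :
    (A - algebraMap ℝ _ t) *ᵥ x = A *ᵥ x - t • x := by
  rw [sub_mulVec, Algebra.algebraMap_eq_smul_one, smul_mulVec, one_mulVec]

theorem re_star_dotProduct_sub_algebraMap (A : Matrix n n 𝕜) (t : ℝ) (x : n → 𝕜) :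
    RCLike.re (star x ⬝ᵥ (A - algebraMap ℝ _ t) *ᵥ x) =
      RCLike.re (star x ⬝ᵥ A *ᵥ x) - t * ∑ i, ‖x i‖ ^ 2 := by
  rw [sub_algebraMap_mulVec, dotProduct_sub, dotProduct_smul, star_dotProduct_self_eq_sum_norm_sq,
    map_sub, RCLike.smul_re, RCLike.ofReal_re]

section Hermitian

variable {A B : Matrix n n 𝕜} [Nonempty n]

theorem isLeast_lowestEigenvalue (hA : A.IsHermitian) :
    IsLeast (spectrum ℝ A) (lowestEigenvalue A) :=
  ⟨Set.Nonempty.csInf_mem ⟨_, hA.eigenvalues_mem_spectrum_real (Classical.arbitrary n)⟩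
    A.finite_real_spectrum, fun _ h => csInf_le A.finite_real_spectrum.bddBelow h⟩

open scoped ComplexOrder in
theorem posSemidef_sub_lowestEigenvalue (hA : A.IsHermitian) :
    (A - algebraMap ℝ _ (lowestEigenvalue A)).PosSemidef := by
  have hB : (A - algebraMap ℝ _ (lowestEigenvalue A)).IsHermitian :=
    hA.sub (IsSelfAdjoint.algebraMap _ (.all _))
  refine hB.posSemidef_iff_eigenvalues_nonneg.2 fun i => ?_
  have hi := hB.eigenvalues_mem_spectrum_real i
  rw [← spectrum.sub_singleton_eq] at hi
  obtain ⟨t, ht, _, rfl, h⟩ := hi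
  have := (isLeast_lowestEigenvalue hA).2 ht
  rw [Pi.zero_apply, ← h]
  exact sub_nonneg.2 this

theorem lowestEigenvalue_mul_le (hA : A.IsHermitian) (x : n → 𝕜) :
    lowestEigenvalue A * ∑ i, ‖x i‖ ^ 2 ≤ RCLike.re (star x ⬝ᵥ A *ᵥ x) := by
  have := (posSemidef_sub_lowestEigenvalue hA).re_dotProduct_nonneg x
  rw [re_star_dotProduct_sub_algebraMap] at this
  linarith

open scoped ComplexOrder in
theorem mulVec_eq_of_rayleigh_le (hA : A.IsHermitian) {x : n → 𝕜}
    (h : RCLike.re (star x ⬝ᵥ A *ᵥ x) ≤ lowestEigenvalue A * ∑ i, ‖x i‖ ^ 2) :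
    A *ᵥ x = lowestEigenvalue A • x := by
  have hB := posSemidef_sub_lowestEigenvalue hA
  have hre := re_star_dotProduct_sub_algebraMap A (lowestEigenvalue A) x
  have hzero : star x ⬝ᵥ (A - algebraMap ℝ _ (lowestEigenvalue A)) *ᵥ x = 0 := by
    obtain ⟨hnonneg, him⟩ := RCLike.nonneg_iff.1 (hB.dotProduct_mulVec_nonneg x)
    exact RCLike.ext (le_antisymm (by rw [hre, map_zero]; linarith) (by simpa using hnonneg))
      (by simpa using him)
  have hker := (hB.dotProduct_mulVec_zero_iff x).1 hzero
  rwa [sub_algebraMap_mulVec, sub_eq_zero] at hker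

theorem lowestEigenvalue_sub_le (hA : A.IsHermitian) (hB : B.IsHermitian) :
    lowestEigenvalue B - lowestEigenvalue A ≤ ∑ i, ∑ j, ‖B i j - A i j‖ := by
  obtain ⟨x, hx, h⟩ := mem_spectrum_real_iff_exists_mulVec.1 (isLeast_lowestEigenvalue hA).1
  have hbound := (le_abs_self _).trans (abs_re_star_dotProduct_mulVec_le (B - A) x)
  rw [sub_mulVec, dotProduct_sub, map_sub, re_star_dotProduct_of_mulVec_eq h] at hbound
  refine le_of_mul_le_mul_right ?_ (sum_norm_sq_pos hx)
  rw [sub_mul]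
  exact (sub_le_sub_right (lowestEigenvalue_mul_le hB x) _).trans hbound

theorem continuous_lowestEigenvalue {X : Type*} [TopologicalSpace X] {A : X → Matrix n n 𝕜}
    (hA : ∀ x, (A x).IsHermitian) (hc : Continuous A) :
    Continuous fun x => lowestEigenvalue (A x) := by
  refine continuous_iff_continuousAt.2 fun a => ?_
  have hlim : Tendsto (fun x => ∑ i, ∑ j, ‖A x i j - A a i j‖) (𝓝 a) (𝓝 0) := by
    have : Continuous fun x => ∑ i, ∑ j, ‖A x i j - A a i j‖ := by fun_prop
    simpa using this.tendsto a
  refine tendsto_iff_dist_tendsto_zero.2 (squeeze_zero (fun _ => dist_nonneg) (fun x => ?_) hlim)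
  refine abs_sub_le_iff.2 ⟨lowestEigenvalue_sub_le (hA a) (hA x), ?_⟩
  simpa only [norm_sub_rev] using lowestEigenvalue_sub_le (hA x) (hA a)

end Hermitian

theorem maxGenEigenspace_toLin'_eq_eigenspace {A : Matrix n n 𝕜} (hA : A.IsHermitian) (t : 𝕜) :
    maxGenEigenspace (toLin' A) t = eigenspace (toLin' A) t := by
  have hss : IsFinitelySemisimple (toEuclideanLin A) :=
    (isSymmetric_toEuclideanLin_iff.2 hA).isFinitelySemisimple
  have hss' : IsFinitelySemisimple (toLin' A) := by
    rw [isFinitelySemisimple_iff_isSemisimple] at hss ⊢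
    exact (LinearEquiv.isSemisimple_iff (toEuclideanLin A) (toLin' A)
      (WithLp.linearEquiv 2 𝕜 (n → 𝕜)) rfl).1 hss
  exact hss'.maxGenEigenspace_eq_eigenspace t

theorem eval_derivative_charpoly_ne_zero {A : Matrix n n 𝕜} (hA : A.IsHermitian) {t : 𝕜}
    (ht : Module.finrank 𝕜 (eigenspace (toLin' A) t) = 1) :
    A.charpoly.derivative.eval t ≠ 0 := by
  have hmult : A.charpoly.rootMultiplicity t = 1 := by
    rw [← ht, ← maxGenEigenspace_toLin'_eq_eigenspace hA, LinearMap.finrank_maxGenEigenspace_eq,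
      charpoly_toLin']
  have hroot : A.charpoly.IsRoot t :=
    (Polynomial.rootMultiplicity_pos A.charpoly_monic.ne_zero).1 (hmult ▸ one_pos)
  exact fun h => hmult.not_gt
    ((Polynomial.one_lt_rootMultiplicity_iff_isRoot A.charpoly_monic.ne_zero).2 ⟨hroot, h⟩)

section Smooth

variable {E : Type*} [NormedAddCommGroup E] [NormedSpace ℝ E]

theorem contDiff_eval_charpoly {k : ℕ∞ω} {A : E → Matrix n n 𝕜}
    (hs : ∀ i j, ContDiff ℝ k fun x => A x i j) :
    ContDiff ℝ k fun p : E × 𝕜 => (A p.1).charpoly.eval p.2 := by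
  simp only [eval_charpoly, det_apply]
  refine ContDiff.sum fun σ _ => ContDiff.const_smul _ (contDiff_prod fun i _ => ?_)
  simp only [Matrix.sub_apply, scalar_apply, diagonal_apply]
  refine ContDiff.sub ?_ ((hs _ _).comp contDiff_fst)
  split_ifs
  · exact contDiff_snd
  · exact contDiff_const

theorem contDiffAt_of_apply_eq_zero [CompleteSpace E] {k : ℕ∞ω} (hk : k ≠ 0)
    {F : E × 𝕜 → 𝕜} {l : E → 𝕜} {a : E} {D : 𝕜} (hF : ContDiffAt ℝ k F (a, l a))
    (hD : HasDerivAt (fun z => F (a, z)) D (l a)) (hD0 : D ≠ 0) (hl : ContinuousAt l a)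
    (hzero : ∀ x, F (x, l x) = 0) : ContDiffAt ℝ k l a := by
  have hinv : (fderiv ℝ F (a, l a) ∘L .inr ℝ E 𝕜).IsInvertible := by
    have hpartial : HasFDerivAt (fun z => F (a, z)) (fderiv ℝ F (a, l a) ∘L .inr ℝ E 𝕜) (l a) :=
      (hF.differentiableAt hk).hasFDerivAt.comp (l a) (hasFDerivAt_prodMk_right a _)
    rw [hpartial.unique (hD.hasFDerivAt.restrictScalars ℝ)]
    exact ⟨(ContinuousLinearEquiv.unitsEquivAut 𝕜 (Units.mk0 D hD0)).restrictScalars ℝ,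
      by ext; simp⟩
  refine (hF.contDiffAt_implicitFunction hk hinv).congr_of_eventuallyEq ?_
  filter_upwards [(continuousAt_id.prodMk hl).eventually
    (hF.eventually_apply_eq_iff_implicitFunction hk hinv)] with x hx
  exact (hx.1 ((hzero x).trans (hzero a).symm)).symm

theorem contDiffAt_lowestEigenvalue [CompleteSpace E] [Nonempty n] {k : ℕ∞ω} (hk : k ≠ 0)
    {A : E → Matrix n n 𝕜} (hA : ∀ x, (A x).IsHermitian)
    (hs : ∀ i j, ContDiff ℝ k fun x => A x i j) {a : E}
    (hsimple : Module.finrank 𝕜 (eigenspace (toLin' (A a)) (lowestEigenvalue (A a) : 𝕜)) = 1) :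
    ContDiffAt ℝ k (fun x => lowestEigenvalue (A x)) a := by
  have hcont : Continuous fun x => (lowestEigenvalue (A x) : 𝕜) :=
    RCLike.continuous_ofReal.comp
      (continuous_lowestEigenvalue hA (continuous_matrix fun i j => (hs i j).continuous))
  have hroot (x : E) : (A x).charpoly.eval (lowestEigenvalue (A x) : 𝕜) = 0 :=
    Matrix.mem_spectrum_iff_isRoot_charpoly.1
      ((spectrum.algebraMap_mem_iff 𝕜).2 (isLeast_lowestEigenvalue (hA x)).1)
  have hC : ContDiffAt ℝ k (fun x => (lowestEigenvalue (A x) : 𝕜)) a :=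
    contDiffAt_of_apply_eq_zero hk (F := fun p => (A p.1).charpoly.eval p.2)
      (contDiff_eval_charpoly hs).contDiffAt ((A a).charpoly.hasDerivAt _)
      (eval_derivative_charpoly_ne_zero (hA a) hsimple) hcont.continuousAt hroot
  have hre := (RCLike.reCLM (K := 𝕜)).contDiff.contDiffAt.comp a hC
  exact hre.congr_of_eventuallyEq (.of_forall fun x => (RCLike.ofReal_re _).symm)

end Smooth

end LowestEigenvalue

section InverseOrder

open Matrix
open scoped ComplexOrder

variable {𝕜 n : Type*} [RCLike 𝕜] [Fintype n] [DecidableEq n] {A B : Matrix n n 𝕜}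

/-- Both sides are the Schur complements of the block matrix `[[B, 1], [1, A⁻¹]]`. -/
theorem posSemidef_inv_sub_inv (hA : A.PosDef) (hB : B.PosDef) (h : (B - A).PosSemidef) :
    (A⁻¹ - B⁻¹).PosSemidef := by
  have := hB.isUnit.invertible
  have := hA.inv.isUnit.invertible
  have hblocks : (fromBlocks B 1 1ᴴ A⁻¹).PosSemidef := by
    rw [hA.inv.fromBlocks₂₂]
    simpa [nonsing_inv_nonsing_inv _ ((isUnit_iff_isUnit_det _).1 hA.isUnit)] using h
  simpa using (hB.fromBlocks₁₁ 1 A⁻¹).1 hblocks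

theorem posSemidef_smul_inv_sub_inv (hA : A.PosDef) (hB : B.PosDef) {C : ℝ} (hC : 0 < C)
    (h : (C • B - A).PosSemidef) : (C • A⁻¹ - B⁻¹).PosSemidef := by
  have hCB : (C • B).PosDef := hB.smul hC
  have hinv : (C • B)⁻¹ = C⁻¹ • B⁻¹ := by
    refine inv_eq_right_inv ?_
    rw [smul_mul_smul_comm, mul_inv_cancel₀ hC.ne', one_smul,
      mul_nonsing_inv _ ((isUnit_iff_isUnit_det _).1 hB.isUnit)]
  have := (posSemidef_inv_sub_inv hA hCB h).smul hC.le
  rwa [hinv, smul_sub, smul_inv_smul₀ hC.ne'] at this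

end InverseOrder

section Hessian

open Filter Topology Matrix

theorem deriv_deriv_nonneg_of_isLocalMin {h : ℝ → ℝ} {a : ℝ} (hmin : IsLocalMin h a)
    (hc : ContinuousAt h a) : 0 ≤ deriv (deriv h) a := by
  by_contra! hneg
  have hmax := isLocalMax_of_deriv_deriv_neg hneg hmin.deriv_eq_zero hc
  have hconst : h =ᶠ[𝓝 a] fun _ => h a := by
    filter_upwards [hmin, hmax] with x hge hle using le_antisymm hle hge
  exact hneg.ne (by simpa using hconst.deriv.deriv_eq)

section NormedSpace

variable {E : Type*} [NormedAddCommGroup E] [NormedSpace ℝ E] {f g : E → ℝ} {a : E}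

theorem deriv_deriv_line (hf : ContDiffAt ℝ 2 f a) (x : E) :
    deriv (deriv fun t : ℝ => f (a + t • x)) 0 = fderiv ℝ (fderiv ℝ f) a x x := by
  have hline (t : ℝ) : HasDerivAt (fun s : ℝ => a + s • x) x t := by
    simpa using ((hasDerivAt_id t).smul_const x).const_add a
  have hlim : Tendsto (fun t : ℝ => a + t • x) (𝓝 0) (𝓝 a) := by
    simpa using (hline 0).continuousAt.tendsto
  have hfirst : deriv (fun t : ℝ => f (a + t • x)) =ᶠ[𝓝 0] fun t => fderiv ℝ f (a + t • x) x := by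
    filter_upwards [hlim.eventually (hf.eventually (by simp))] with t ht
    exact ((ht.differentiableAt (by simp)).hasFDerivAt.comp_hasDerivAt t (hline t)).deriv
  have hsecond : HasFDerivAt (fderiv ℝ f) (fderiv ℝ (fderiv ℝ f) a) (a + (0 : ℝ) • x) := by
    rw [zero_smul, add_zero]
    exact ((hf.fderiv_right (m := 1) (by norm_num)).differentiableAt (by simp)).hasFDerivAt
  rw [hfirst.deriv_eq]
  exact ((ContinuousLinearMap.apply ℝ ℝ x).hasFDerivAt.comp_hasDerivAt (0 : ℝ)
    (hsecond.comp_hasDerivAt (0 : ℝ) (hline 0))).deriv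

theorem fderiv_fderiv_nonneg_of_isLocalMin (hf : ContDiffAt ℝ 2 f a) (hmin : IsLocalMin f a)
    (x : E) : 0 ≤ fderiv ℝ (fderiv ℝ f) a x x := by
  have hline : ContinuousAt (fun t : ℝ => a + t • x) 0 := by fun_prop
  have ha : a + (0 : ℝ) • x = a := by simp
  rw [← deriv_deriv_line hf]
  refine deriv_deriv_nonneg_of_isLocalMin ?_ ?_
  · exact IsMinFilter.comp_tendsto (g := fun t : ℝ => a + t • x) (b := 0) (by rwa [ha])
      (by simpa using hline.tendsto)
  · exact ContinuousAt.comp (f := fun t : ℝ => a + t • x) (by rw [ha]; exact hf.continuousAt) hline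

theorem fderiv_fderiv_le_of_sub_le_sub (hf : ContDiffAt ℝ 2 f a) (hg : ContDiffAt ℝ 2 g a)
    (hle : ∀ y, g y - g a ≤ f y - f a) (x : E) :
    fderiv ℝ (fderiv ℝ g) a x x ≤ fderiv ℝ (fderiv ℝ f) a x x := by
  have hmin : IsLocalMin (fun y => f y - g y) a :=
    .of_forall fun y => by linarith [hle y]
  have hfirst : fderiv ℝ (fun y => f y - g y) =ᶠ[𝓝 a] fderiv ℝ f - fderiv ℝ g := by
    filter_upwards [hf.eventually (by simp), hg.eventually (by simp)] with y hfy hgy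
    exact fderiv_fun_sub (hfy.differentiableAt (by simp)) (hgy.differentiableAt (by simp))
  have hnonneg := fderiv_fderiv_nonneg_of_isLocalMin (hf.sub hg) hmin x
  rw [hfirst.fderiv_eq,
    fderiv_sub ((hf.fderiv_right (m := 1) (by norm_num)).differentiableAt (by simp))
      ((hg.fderiv_right (m := 1) (by norm_num)).differentiableAt (by simp))] at hnonneg
  simpa using hnonneg

theorem fderiv_fderiv_const_mul (C : ℝ) (f : E → ℝ) (a x : E) :
    fderiv ℝ (fderiv ℝ fun y => C * f y) a x x = C * fderiv ℝ (fderiv ℝ f) a x x := by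
  have hfirst : fderiv ℝ (fun y => C * f y) = C • fderiv ℝ f := fderiv_const_smul_field C
  have hsecond : fderiv ℝ (C • fderiv ℝ f) = C • fderiv ℝ (fderiv ℝ f) :=
    fderiv_const_smul_field (F := E →L[ℝ] ℝ) C
  rw [hfirst, hsecond]
  rfl

theorem fderiv_fderiv_one_sub_cos (ℓ : E →L[ℝ] ℝ) (x : E) :
    fderiv ℝ (fderiv ℝ fun y => 1 - Real.cos (ℓ y)) 0 x x = ℓ x ^ 2 := by
  have hfirst : fderiv ℝ (fun y => 1 - Real.cos (ℓ y)) = fun y => Real.sin (ℓ y) • ℓ := by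
    ext1 y
    rw [(ℓ.hasFDerivAt (x := y).cos.const_sub 1).fderiv]
    ext z
    simp
  have hsecond : HasFDerivAt (fun y => Real.sin (ℓ y) • ℓ) _ 0 := ℓ.hasFDerivAt.sin.smul_const ℓ
  rw [hfirst, hsecond.fderiv]
  simp [sq]

end NormedSpace

variable {ι : Type*} [Fintype ι] [DecidableEq ι] {f g : (ι → ℝ) → ℝ} {a : ι → ℝ}

/-- The Hessian matrix `∂²f(a) / ∂θ_i ∂θ_j`. -/
def hessianMatrix (f : (ι → ℝ) → ℝ) (a : ι → ℝ) : Matrix ι ι ℝ :=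
  .of fun i j => fderiv ℝ (fun θ => fderiv ℝ f θ (Pi.single j 1)) a (Pi.single i 1)

theorem hessianMatrix_apply (hf : ContDiffAt ℝ 2 f a) (i j : ι) :
    hessianMatrix f a i j = fderiv ℝ (fderiv ℝ f) a (Pi.single i 1) (Pi.single j 1) := by
  have hd : DifferentiableAt ℝ (fderiv ℝ f) a :=
    (hf.fderiv_right (m := 1) (by norm_num)).differentiableAt (by simp)
  rw [hessianMatrix, of_apply, fderiv_clm_apply hd (differentiableAt_const _)]
  simp

theorem isHermitian_hessianMatrix (hf : ContDiffAt ℝ 2 f a) : (hessianMatrix f a).IsHermitian := by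
  ext i j
  rw [conjTranspose_apply, star_trivial, hessianMatrix_apply hf, hessianMatrix_apply hf,
    (hf.isSymmSndFDerivAt (by simp)).eq]

theorem dotProduct_hessianMatrix_mulVec (hf : ContDiffAt ℝ 2 f a) (x : ι → ℝ) :
    x ⬝ᵥ hessianMatrix f a *ᵥ x = fderiv ℝ (fderiv ℝ f) a x x := by
  have hx : x = ∑ i, x i • (Pi.single i 1 : ι → ℝ) := pi_eq_sum_univ' x
  conv_rhs => rw [hx]
  simp only [dotProduct, mulVec, hessianMatrix_apply hf, map_sum, map_smul,
    _root_.sum_apply, _root_.smul_apply, smul_eq_mul, Finset.mul_sum]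
  rw [Finset.sum_comm]
  exact Finset.sum_congr rfl fun i _ => Finset.sum_congr rfl fun j _ => by ring

theorem posSemidef_smul_hessianMatrix_sub (hf : ContDiffAt ℝ 2 f a) (hg : ContDiffAt ℝ 2 g a)
    {C : ℝ} (hle : ∀ y, g y - g a ≤ C * (f y - f a)) :
    (C • hessianMatrix f a - hessianMatrix g a).PosSemidef := by
  refine .of_dotProduct_mulVec_nonneg
    (((isHermitian_hessianMatrix hf).smul (.all C)).sub (isHermitian_hessianMatrix hg)) fun x => ?_
  have hfg := fderiv_fderiv_le_of_sub_le_sub (contDiffAt_const (c := C).mul hf) hg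
    (fun y => by linarith [hle y]) x
  rw [fderiv_fderiv_const_mul] at hfg
  rw [star_trivial, sub_mulVec, smul_mulVec, dotProduct_sub, dotProduct_smul,
    dotProduct_hessianMatrix_mulVec hf, dotProduct_hessianMatrix_mulVec hg]
  exact sub_nonneg.2 hfg

theorem posDef_hessianMatrix_of_one_sub_cos_le (hf : ContDiffAt ℝ 2 f 0)
    (hlow : ∀ i, ∃ c > 0, ∀ θ, c * (1 - Real.cos (θ i)) ≤ f θ - f 0) :
    (hessianMatrix f 0).PosDef := by
  refine .of_dotProduct_mulVec_pos (isHermitian_hessianMatrix hf) fun x hx => ?_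
  obtain ⟨i, hi⟩ := Function.ne_iff.1 hx
  obtain ⟨c, hc, hle⟩ := hlow i
  let g (θ : ι → ℝ) : ℝ := 1 - Real.cos ((ContinuousLinearMap.proj i : (ι → ℝ) →L[ℝ] ℝ) θ)
  have hg : ContDiffAt ℝ 2 (fun θ => c * g θ) 0 := by fun_prop
  have hsnd := fderiv_fderiv_le_of_sub_le_sub hf hg (fun θ => by simpa [g] using hle θ) x
  rw [fderiv_fderiv_const_mul, fderiv_fderiv_one_sub_cos] at hsnd
  rw [star_trivial, dotProduct_hessianMatrix_mulVec hf]
  exact (mul_pos hc (sq_pos_of_ne_zero hi)).trans_le hsnd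

end Hessian

section WeightedGraph

open Matrix Module.End

/-- A weighted graph, possibly with loops and multiple edges. `E` is the set of oriented edges, and
opposite edges carry the same positive weight; an edge may be its own opposite. -/
structure WeightedGraph (X E : Type*) where
  /-- the initial vertex of an oriented edge -/
  src : E → X
  /-- the terminal vertex of an oriented edge -/
  tgt : E → X
  /-- the opposite oriented edge -/
  rev : E → E
  /-- the weight of an oriented edge -/
  weight : E → ℝ
  rev_rev : Function.Involutive rev
  src_rev : ∀ e, src (rev e) = tgt e
  weight_rev : ∀ e, weight (rev e) = weight e
  weight_pos : ∀ e, 0 < weight e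

namespace WeightedGraph

variable {X E : Type*}

theorem tgt_rev (Γ : WeightedGraph X E) (e : E) : Γ.tgt (Γ.rev e) = Γ.src e := by
  rw [← Γ.src_rev, Γ.rev_rev]

/-- The graph is connected: any vertex is reached from any other one along oriented edges. -/
def Connected (Γ : WeightedGraph X E) : Prop :=
  ∀ u v, Relation.ReflTransGen (fun a b => ∃ e, Γ.src e = a ∧ Γ.tgt e = b) u v

theorem Connected.induction {Γ : WeightedGraph X E} (hΓ : Γ.Connected) {p : X → Prop} {u : X}
    (hu : p u) (step : ∀ e, p (Γ.src e) → p (Γ.tgt e)) (v : X) : p v := by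
  induction hΓ u v with
  | refl => exact hu
  | tail _ hedge ih =>
    obtain ⟨e, rfl, rfl⟩ := hedge
    exact step e ih

/-- A gain function: a unimodular factor on every oriented edge, inverted by reversal. It encodes a
magnetic potential, or the quasi-momentum of a fiber operator. -/
def IsGain (Γ : WeightedGraph X E) (z : E → Circle) : Prop := ∀ e, z (Γ.rev e) = (z e)⁻¹

theorem isGain_one (Γ : WeightedGraph X E) : Γ.IsGain 1 := fun _ => inv_one.symm

variable [Fintype E] [DecidableEq X]

/-- `ψ` is a positive solution of the equation `A ψ = μ ψ`, where `A` is the Schrödinger operator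
with potential `q` and trivial gains. The equation is stated over `ℝ`. -/
structure IsPositiveSolution (Γ : WeightedGraph X E) (q : X → ℝ) (μ : ℝ) (ψ : X → ℝ) :
    Prop where
  pos : ∀ v, 0 < ψ v
  sum_eq : ∀ v, ∑ e with Γ.src e = v, Γ.weight e * ψ (Γ.tgt e) = (q v - μ) * ψ v

/-- The Schrödinger operator `(A x)(v) = q(v) x(v) - ∑_{e = (v, u)} w(e) z(e) x(u)` with potential
`q` and gains `z`. -/
def schrodinger (Γ : WeightedGraph X E) (q : X → ℝ) (z : E → Circle) : Matrix X X ℂ :=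
  diagonal (fun v => (q v : ℂ)) - ∑ e, single (Γ.src e) (Γ.tgt e) (Γ.weight e * z e : ℂ)

/-- The energy `½ ∑_{e = (u, v)} w(e) ψ(u) ψ(v) |g(u) - z(e) g(v)|²` of `g`, relative to `ψ`. -/
def energy (Γ : WeightedGraph X E) (z : E → Circle) (ψ : X → ℝ) (g : X → ℂ) : ℝ :=
  (∑ e, Γ.weight e * (ψ (Γ.src e) * ψ (Γ.tgt e)) * ‖g (Γ.src e) - z e * g (Γ.tgt e)‖ ^ 2) / 2

variable {Γ : WeightedGraph X E} {q : X → ℝ} {μ : ℝ} {ψ : X → ℝ} {z : E → Circle}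

omit [DecidableEq X] in
theorem sum_tgt_eq_sum_src (Γ : WeightedGraph X E) (ψ c : X → ℝ) :
    ∑ e, Γ.weight e * (ψ (Γ.src e) * ψ (Γ.tgt e)) * c (Γ.tgt e) =
      ∑ e, Γ.weight e * (ψ (Γ.src e) * ψ (Γ.tgt e)) * c (Γ.src e) := by
  rw [← Equiv.sum_comp (Function.Involutive.toPerm Γ.rev Γ.rev_rev)]
  refine Finset.sum_congr rfl fun e _ => ?_
  rw [Function.Involutive.coe_toPerm, Γ.weight_rev, Γ.src_rev, Γ.tgt_rev,
    mul_comm (ψ (Γ.tgt e))]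

theorem isHermitian_schrodinger (q : X → ℝ) (hz : Γ.IsGain z) :
    (Γ.schrodinger q z).IsHermitian := by
  refine (isHermitian_diagonal_of_self_adjoint _ ?_).sub ?_
  · ext v
    simp
  · rw [IsHermitian, conjTranspose_sum,
      ← Equiv.sum_comp (Function.Involutive.toPerm Γ.rev Γ.rev_rev)]
    refine Finset.sum_congr rfl fun e _ => ?_
    rw [Function.Involutive.coe_toPerm, conjTranspose_single, Γ.src_rev, Γ.tgt_rev, Γ.weight_rev,
      hz, Circle.coe_inv_eq_conj]
    simp

omit [DecidableEq X] in
theorem energy_nonneg (Γ : WeightedGraph X E) (hψ : ∀ v, 0 ≤ ψ v) (z : E → Circle) (g : X → ℂ) :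
    0 ≤ Γ.energy z ψ g :=
  div_nonneg (Finset.sum_nonneg fun e _ => mul_nonneg
    (mul_nonneg (Γ.weight_pos e).le (mul_nonneg (hψ _) (hψ _))) (sq_nonneg _)) zero_le_two

omit [DecidableEq X] in
theorem mul_norm_sub_sq_le_energy (Γ : WeightedGraph X E) (hψ : ∀ v, 0 ≤ ψ v) (z : E → Circle)
    (g : X → ℂ) (e : E) :
    Γ.weight e * (ψ (Γ.src e) * ψ (Γ.tgt e)) * ‖g (Γ.src e) - z e * g (Γ.tgt e)‖ ^ 2 ≤
      2 * Γ.energy z ψ g := by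
  rw [energy, mul_div_cancel₀ _ two_ne_zero]
  exact Finset.single_le_sum (f := fun e => Γ.weight e * (ψ (Γ.src e) * ψ (Γ.tgt e)) *
    ‖g (Γ.src e) - z e * g (Γ.tgt e)‖ ^ 2) (fun e _ => mul_nonneg
    (mul_nonneg (Γ.weight_pos e).le (mul_nonneg (hψ _) (hψ _))) (sq_nonneg _)) (Finset.mem_univ e)

omit [DecidableEq X] in
theorem energy_le_mul_energy (Γ : WeightedGraph X E) {φ : X → ℝ} (hψ : ∀ v, 0 ≤ ψ v) {b : ℝ}
    (hle : ∀ v, ψ v ≤ b * φ v) (z : E → Circle) (g : X → ℂ) :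
    Γ.energy z ψ g ≤ b ^ 2 * Γ.energy z φ g := by
  rw [energy, energy, mul_div_assoc', Finset.mul_sum]
  refine div_le_div_of_nonneg_right (Finset.sum_le_sum fun e _ => ?_) zero_le_two
  have hprod : ψ (Γ.src e) * ψ (Γ.tgt e) ≤ b ^ 2 * (φ (Γ.src e) * φ (Γ.tgt e)) := by
    calc ψ (Γ.src e) * ψ (Γ.tgt e) ≤ b * φ (Γ.src e) * (b * φ (Γ.tgt e)) :=
          mul_le_mul (hle _) (hle _) (hψ _) ((hψ _).trans (hle _))
      _ = b ^ 2 * (φ (Γ.src e) * φ (Γ.tgt e)) := by ring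
  have := (Γ.weight_pos e).le
  calc _ ≤ Γ.weight e * (b ^ 2 * (φ (Γ.src e) * φ (Γ.tgt e))) *
        ‖g (Γ.src e) - z e * g (Γ.tgt e)‖ ^ 2 := by gcongr
    _ = _ := by ring

variable [Fintype X]

theorem schrodinger_mulVec (Γ : WeightedGraph X E) (q : X → ℝ) (z : E → Circle) (x : X → ℂ)
    (v : X) : (Γ.schrodinger q z *ᵥ x) v =
      q v * x v - ∑ e with Γ.src e = v, (Γ.weight e * z e : ℂ) * x (Γ.tgt e) := by
  rw [schrodinger, sub_mulVec, Pi.sub_apply, mulVec_diagonal, sum_mulVec, Finset.sum_apply,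
    Finset.sum_filter]
  congr 1
  refine Finset.sum_congr rfl fun e _ => ?_
  rw [single_mulVec]
  simp [Function.update_apply, eq_comm]

theorem re_star_dotProduct_schrodinger_mulVec (Γ : WeightedGraph X E) (q : X → ℝ)
    (z : E → Circle) (x : X → ℂ) :
    RCLike.re (star x ⬝ᵥ Γ.schrodinger q z *ᵥ x) = ∑ v, q v * ‖x v‖ ^ 2 -
      ∑ e, Γ.weight e * (star (x (Γ.src e)) * (z e * x (Γ.tgt e))).re := by
  simp only [dotProduct, schrodinger_mulVec, Pi.star_apply, mul_sub, Finset.sum_sub_distrib,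
    RCLike.re_eq_complex_re, Complex.sub_re, Complex.re_sum]
  congr 1
  · refine Finset.sum_congr rfl fun v _ => ?_
    rw [mul_left_comm, Complex.re_ofReal_mul, RCLike.star_def, Complex.conj_mul',
      ← Complex.ofReal_pow, Complex.ofReal_re]
  · rw [← Finset.sum_fiberwise Finset.univ Γ.src]
    refine Finset.sum_congr rfl fun v _ => ?_
    rw [Finset.mul_sum, Complex.re_sum]
    refine Finset.sum_congr rfl fun e he => ?_
    rw [(Finset.mem_filter.1 he).2, ← Complex.re_ofReal_mul]
    ring_nf

theorem schrodinger_one_mulVec_eq_iff {Γ : WeightedGraph X E} {q : X → ℝ} {μ : ℝ} {ψ : X → ℝ} :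
    (Γ.schrodinger q 1 *ᵥ fun v => (ψ v : ℂ)) = μ • (fun v => (ψ v : ℂ)) ↔
      ∀ v, ∑ e with Γ.src e = v, Γ.weight e * ψ (Γ.tgt e) = (q v - μ) * ψ v := by
  rw [funext_iff]
  refine forall_congr' fun v => ?_
  rw [schrodinger_mulVec]
  simp only [Pi.one_apply, Circle.coe_one, mul_one, Pi.smul_apply, Complex.real_smul]
  norm_cast
  constructor <;> intro h <;> linarith

namespace IsPositiveSolution

theorem sum_sub_mul_norm_sq (h : Γ.IsPositiveSolution q μ ψ) (g : X → ℂ) :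
    ∑ v, (q v - μ) * ‖ψ v • g v‖ ^ 2 =
      ∑ e, Γ.weight e * (ψ (Γ.src e) * ψ (Γ.tgt e)) * ‖g (Γ.src e)‖ ^ 2 := by
  rw [← Finset.sum_fiberwise Finset.univ Γ.src]
  refine Finset.sum_congr rfl fun v _ => ?_
  calc (q v - μ) * ‖ψ v • g v‖ ^ 2 = (q v - μ) * ψ v * (ψ v * ‖g v‖ ^ 2) := by
        rw [norm_smul_of_nonneg (h.pos v).le]
        ring
    _ = ∑ e with Γ.src e = v, Γ.weight e * ψ (Γ.tgt e) * (ψ v * ‖g v‖ ^ 2) := by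
        rw [← h.sum_eq v, Finset.sum_mul]
    _ = _ := Finset.sum_congr rfl fun e he => by
        rw [(Finset.mem_filter.1 he).2]
        ring

/-- The ground state representation: the substitution `x = ψ g` turns the quadratic form of
`A - μ` into an energy in which the potential no longer appears. -/
theorem re_form_eq_energy (h : Γ.IsPositiveSolution q μ ψ) (z : E → Circle) (g : X → ℂ) :
    RCLike.re (star (fun v => ψ v • g v) ⬝ᵥ Γ.schrodinger q z *ᵥ fun v => ψ v • g v) =
      μ * ∑ v, ‖ψ v • g v‖ ^ 2 + Γ.energy z ψ g := by
  have hcross (e : E) : Γ.weight e * (ψ (Γ.src e) * ψ (Γ.tgt e)) *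
        ‖g (Γ.src e) - z e * g (Γ.tgt e)‖ ^ 2 =
      Γ.weight e * (ψ (Γ.src e) * ψ (Γ.tgt e)) * ‖g (Γ.src e)‖ ^ 2 +
      Γ.weight e * (ψ (Γ.src e) * ψ (Γ.tgt e)) * ‖g (Γ.tgt e)‖ ^ 2 -
      2 * (Γ.weight e *
        (star (ψ (Γ.src e) • g (Γ.src e)) * (z e * (ψ (Γ.tgt e) • g (Γ.tgt e)))).re) := by
    have hre : (star (ψ (Γ.src e) • g (Γ.src e)) * (z e * (ψ (Γ.tgt e) • g (Γ.tgt e)))).re =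
        ψ (Γ.src e) * ψ (Γ.tgt e) * (inner ℂ (g (Γ.src e)) (z e * g (Γ.tgt e))).re := by
      rw [RCLike.inner_apply, ← Complex.re_ofReal_mul]
      simp only [Complex.real_smul, star_mul', RCLike.star_def, Complex.conj_ofReal]
      push_cast
      ring_nf
    rw [hre, norm_sub_sq (𝕜 := ℂ), norm_mul, Circle.norm_coe, RCLike.re_eq_complex_re]
    ring
  have hdiag : ∑ v, (q v - μ) * ‖ψ v • g v‖ ^ 2 =
      ∑ v, q v * ‖ψ v • g v‖ ^ 2 - μ * ∑ v, ‖ψ v • g v‖ ^ 2 := by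
    simp only [sub_mul, Finset.sum_sub_distrib, Finset.mul_sum]
  rw [re_star_dotProduct_schrodinger_mulVec, energy, Finset.sum_congr rfl fun e _ => hcross e,
    Finset.sum_sub_distrib, Finset.sum_add_distrib, ← Finset.mul_sum,
    Γ.sum_tgt_eq_sum_src ψ fun v => ‖g v‖ ^ 2, ← h.sum_sub_mul_norm_sq, hdiag]
  ring

variable {φ p : X → ℝ} {ν : ℝ}

theorem lowestEigenvalue_sub_mul_le_energy [Nonempty X] (h : Γ.IsPositiveSolution q μ ψ)
    (hz : Γ.IsGain z) (g : X → ℂ) :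
    (lowestEigenvalue (Γ.schrodinger q z) - μ) * ∑ v, ‖ψ v • g v‖ ^ 2 ≤ Γ.energy z ψ g := by
  have hform := lowestEigenvalue_mul_le (isHermitian_schrodinger q hz) fun v => ψ v • g v
  rw [h.re_form_eq_energy] at hform
  linarith

theorem energy_inv_smul_eq (h : Γ.IsPositiveSolution q μ ψ) {t : ℝ} {x : X → ℂ}
    (hx : Γ.schrodinger q z *ᵥ x = t • x) :
    Γ.energy z ψ (fun v => (ψ v)⁻¹ • x v) = (t - μ) * ∑ v, ‖x v‖ ^ 2 := by
  have hform := h.re_form_eq_energy z fun v => (ψ v)⁻¹ • x v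
  simp only [smul_inv_smul₀ (h.pos _).ne'] at hform
  rw [re_star_dotProduct_of_mulVec_eq hx] at hform
  linarith

theorem exists_energy_eq [Nonempty X] (h : Γ.IsPositiveSolution q μ ψ) (hz : Γ.IsGain z) :
    ∃ g ≠ 0, Γ.energy z ψ g =
      (lowestEigenvalue (Γ.schrodinger q z) - μ) * ∑ v, ‖ψ v • g v‖ ^ 2 := by
  obtain ⟨x, hx, heig⟩ := mem_spectrum_real_iff_exists_mulVec.1
    (isLeast_lowestEigenvalue (isHermitian_schrodinger q hz)).1
  obtain ⟨v, hv⟩ := Function.ne_iff.1 hx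
  refine ⟨fun v => (ψ v)⁻¹ • x v,
    Function.ne_iff.2 ⟨v, smul_ne_zero (inv_ne_zero (h.pos v).ne') hv⟩, ?_⟩
  simp only [smul_inv_smul₀ (h.pos _).ne']
  exact h.energy_inv_smul_eq heig

theorem le_lowestEigenvalue [Nonempty X] (h : Γ.IsPositiveSolution q μ ψ) (hz : Γ.IsGain z) :
    μ ≤ lowestEigenvalue (Γ.schrodinger q z) := by
  obtain ⟨g, hg, heq⟩ := h.exists_energy_eq hz
  have henergy := Γ.energy_nonneg (fun v => (h.pos v).le) z g
  rw [heq] at henergy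
  exact sub_nonneg.1 (nonneg_of_mul_nonneg_left henergy
    (sum_norm_smul_sq_pos (fun v => (h.pos v).ne') hg))

theorem lowestEigenvalue_one [Nonempty X] (h : Γ.IsPositiveSolution q μ ψ) :
    lowestEigenvalue (Γ.schrodinger q 1) = μ := by
  refine le_antisymm ?_ (h.le_lowestEigenvalue Γ.isGain_one)
  refine (isLeast_lowestEigenvalue (isHermitian_schrodinger q Γ.isGain_one)).2
    (mem_spectrum_real_iff_exists_mulVec.2
      ⟨fun v => (ψ v : ℂ), ?_, schrodinger_one_mulVec_eq_iff.2 h.sum_eq⟩)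
  exact Function.ne_iff.2
    ⟨Classical.arbitrary X, Complex.ofReal_ne_zero.2 (h.pos _).ne'⟩

theorem lowestEigenvalue_sub_le_mul [Nonempty X] (hφ : Γ.IsPositiveSolution p μ φ)
    (hψ : Γ.IsPositiveSolution q ν ψ) (hz : Γ.IsGain z) {a b : ℝ} (ha : 0 < a)
    (hlower : ∀ v, a * φ v ≤ ψ v) (hupper : ∀ v, ψ v ≤ b * φ v) :
    lowestEigenvalue (Γ.schrodinger q z) - ν ≤
      (b / a) ^ 2 * (lowestEigenvalue (Γ.schrodinger p z) - μ) := by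
  obtain ⟨g, hg, heq⟩ := hφ.exists_energy_eq hz
  have hmass : ∑ v, ‖φ v • g v‖ ^ 2 ≤ (a ^ 2)⁻¹ * ∑ v, ‖ψ v • g v‖ ^ 2 := by
    rw [Finset.mul_sum]
    refine Finset.sum_le_sum fun v _ => ?_
    rw [le_inv_mul_iff₀ (pow_pos ha 2), ← mul_pow, norm_smul_of_nonneg (hφ.pos v).le,
      norm_smul_of_nonneg (hψ.pos v).le, ← mul_assoc]
    have := hφ.pos v
    gcongr
    exact hlower v
  refine le_of_mul_le_mul_right ?_ (sum_norm_smul_sq_pos (fun v => (hψ.pos v).ne') hg)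
  calc _ ≤ Γ.energy z ψ g := hψ.lowestEigenvalue_sub_mul_le_energy hz g
    _ ≤ b ^ 2 * Γ.energy z φ g :=
      Γ.energy_le_mul_energy (fun v => (hψ.pos v).le) hupper z g
    _ ≤ b ^ 2 * ((lowestEigenvalue (Γ.schrodinger p z) - μ) *
        ((a ^ 2)⁻¹ * ∑ v, ‖ψ v • g v‖ ^ 2)) := by
      have := sub_nonneg.2 (hφ.le_lowestEigenvalue hz)
      rw [heq]
      gcongr
    _ = _ := by
      rw [div_pow]
      ring

theorem exists_eq_smul (h : Γ.IsPositiveSolution q μ ψ) (hΓ : Γ.Connected) {x : X → ℂ}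
    (hx : Γ.schrodinger q 1 *ᵥ x = μ • x) : ∃ c : ℂ, c • (fun v => (ψ v : ℂ)) = x := by
  rcases isEmpty_or_nonempty X with _ | ⟨⟨v₀⟩⟩
  · exact ⟨0, Subsingleton.elim _ _⟩
  have hzero : Γ.energy 1 ψ (fun v => (ψ v)⁻¹ • x v) = 0 := by
    rw [h.energy_inv_smul_eq hx, sub_self, zero_mul]
  refine ⟨(ψ v₀)⁻¹ • x v₀, funext fun v => ?_⟩
  have hconst : (ψ v)⁻¹ • x v = (ψ v₀)⁻¹ • x v₀ := by
    refine hΓ.induction (p := fun v => (ψ v)⁻¹ • x v = (ψ v₀)⁻¹ • x v₀) rfl (fun e he => ?_) v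
    have hedge := Γ.mul_norm_sub_sq_le_energy (fun v => (h.pos v).le) 1
      (fun v => (ψ v)⁻¹ • x v) e
    have hw := mul_pos (Γ.weight_pos e) (mul_pos (h.pos (Γ.src e)) (h.pos (Γ.tgt e)))
    rw [hzero, mul_zero, Pi.one_apply, Circle.coe_one, one_mul] at hedge
    have hnorm := nonpos_of_mul_nonpos_right hedge hw
    rw [← he, eq_comm, ← sub_eq_zero, ← norm_eq_zero]
    exact pow_eq_zero_iff two_ne_zero |>.1 (le_antisymm hnorm (sq_nonneg _))
  rw [Pi.smul_apply, ← hconst, smul_eq_mul, mul_comm, ← Complex.real_smul,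
    smul_inv_smul₀ (h.pos v).ne']

end IsPositiveSolution

/-- If `x` is an eigenvector for the lowest eigenvalue, then `|x|` minimizes the Rayleigh quotient
too. -/
theorem exists_isPositiveSolution [Nonempty X] (hΓ : Γ.Connected) (q : X → ℝ) :
    ∃ ψ, Γ.IsPositiveSolution q (lowestEigenvalue (Γ.schrodinger q 1)) ψ := by
  have hherm := isHermitian_schrodinger q Γ.isGain_one
  obtain ⟨x, hx, heig⟩ := mem_spectrum_real_iff_exists_mulVec.1 (isLeast_lowestEigenvalue hherm).1
  have hrayleigh : RCLike.re (star (fun v => (‖x v‖ : ℂ)) ⬝ᵥ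
      Γ.schrodinger q 1 *ᵥ fun v => (‖x v‖ : ℂ)) ≤
      lowestEigenvalue (Γ.schrodinger q 1) * ∑ v, ‖(‖x v‖ : ℂ)‖ ^ 2 := by
    simp only [Complex.norm_real, norm_norm]
    rw [← re_star_dotProduct_of_mulVec_eq heig]
    simp only [re_star_dotProduct_schrodinger_mulVec, Complex.norm_real, norm_norm]
    refine sub_le_sub_left (Finset.sum_le_sum fun e _ =>
      mul_le_mul_of_nonneg_left ?_ (Γ.weight_pos e).le) _
    refine (Complex.re_le_norm _).trans_eq ?_
    simp [← Complex.ofReal_mul]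
  have hsol := schrodinger_one_mulVec_eq_iff.1 (mulVec_eq_of_rayleigh_le hherm hrayleigh)
  refine ⟨fun v => ‖x v‖, fun v => norm_pos_iff.2 fun hv => hx (funext fun u => ?_), hsol⟩
  refine hΓ.induction (p := fun u => x u = 0) hv (fun e he => ?_) u
  have hsum := hsol (Γ.src e)
  rw [he, norm_zero, mul_zero, Finset.sum_eq_zero_iff_of_nonneg
    fun e _ => mul_nonneg (Γ.weight_pos e).le (norm_nonneg _)] at hsum
  exact norm_eq_zero.1
    ((mul_eq_zero.1 (hsum e (by simp))).resolve_left (Γ.weight_pos e).ne')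

theorem finrank_eigenspace_lowestEigenvalue [Nonempty X] (hΓ : Γ.Connected) (q : X → ℝ) :
    Module.finrank ℂ (eigenspace (toLin' (Γ.schrodinger q 1))
      (lowestEigenvalue (Γ.schrodinger q 1) : ℂ)) = 1 := by
  obtain ⟨ψ, hψ⟩ := exists_isPositiveSolution hΓ q
  have hmem : (fun v => (ψ v : ℂ)) ∈ eigenspace (toLin' (Γ.schrodinger q 1))
      (lowestEigenvalue (Γ.schrodinger q 1) : ℂ) :=
    mem_eigenspace_iff.2 (schrodinger_one_mulVec_eq_iff.2 hψ.sum_eq)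
  refine finrank_eq_one ⟨_, hmem⟩ (fun h => ?_) fun x => ?_
  · exact (hψ.pos (Classical.arbitrary X)).ne'
      (Complex.ofReal_eq_zero.1 (congrFun (congrArg Subtype.val h) _))
  · obtain ⟨c, hc⟩ := hψ.exists_eq_smul hΓ (mem_eigenspace_iff.1 x.2)
    exact ⟨c, Subtype.ext hc⟩

end WeightedGraph

end WeightedGraph

section PeriodicGraph

open Matrix Module.End
open scoped ContDiff

namespace PeriodicGraph

variable {d : ℕ} {V A : Type*} [AddAction (Fin d → ℤ) V] [AddAction (Fin d → ℤ) A]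
  {G : PeriodicGraph d V A} {Q : G.Potential} {ψ : G.QVertex → ℝ}

instance : DecidableEq G.QVertex := Classical.decEq _

theorem exists_mkV (x : G.QVertex) : ∃ v, G.mkV v = x := Quotient.exists_rep x

theorem exists_mkE (x : G.QEdge) : ∃ e, G.mkE e = x := Quotient.exists_rep x

theorem degree_src_pos (G : PeriodicGraph d V A) (e : A) : 0 < G.degree (G.src e) :=
  Finset.card_pos.2 ⟨e, G.mem_star.2 rfl⟩

theorem degree_tgt_pos (G : PeriodicGraph d V A) (e : A) : 0 < G.degree (G.tgt e) :=
  G.src_rev e ▸ G.degree_src_pos (G.rev e)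

theorem degree_pos (hd : 0 < d) (v : V) : 0 < G.degree v := by
  have hne : (Pi.single ⟨0, hd⟩ 1 : Fin d → ℤ) +ᵥ v ≠ v := fun h =>
    one_ne_zero (Pi.single_eq_zero_iff.1 (G.free _ v h))
  rcases (G.connected v _).cases_head with h | ⟨_, ⟨e, rfl, -⟩, -⟩
  · exact absurd h.symm hne
  · exact G.degree_src_pos e

theorem sqrt_qdegree_pos (hd : 0 < d) (x : G.QVertex) : 0 < Real.sqrt (G.qdegree x) := by
  obtain ⟨v, rfl⟩ := exists_mkV x
  exact Real.sqrt_pos.2 (Nat.cast_pos.2 (degree_pos hd v))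

/-- The quotient graph `Γ_*`, with the weight `1 / √(κ_u κ_v)` on an edge `(u, v)`. -/
def fundamentalGraph (G : PeriodicGraph d V A) : WeightedGraph G.QVertex G.QEdge where
  src := G.qsrc
  tgt := G.qtgt
  rev := G.descendE (fun e => G.mkE (G.rev e)) fun m e => G.mkE_eq.2 ⟨m, (G.rev_vadd m e).symm⟩
  weight e := (Real.sqrt ((G.qdegree (G.qsrc e) : ℝ) * (G.qdegree (G.qtgt e) : ℝ)))⁻¹
  rev_rev x := by
    obtain ⟨e, rfl⟩ := exists_mkE x
    exact congrArg G.mkE (G.rev_rev e)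
  src_rev x := by
    obtain ⟨e, rfl⟩ := exists_mkE x
    exact congrArg G.mkV (G.src_rev e)
  weight_rev x := by
    obtain ⟨e, rfl⟩ := exists_mkE x
    change (Real.sqrt ((G.degree (G.src (G.rev e)) : ℝ) * G.degree (G.tgt (G.rev e))))⁻¹ =
      (Real.sqrt ((G.degree (G.src e) : ℝ) * G.degree (G.tgt e)))⁻¹
    rw [G.src_rev, ← G.src_rev (G.rev e), G.rev_rev, mul_comm]
  weight_pos x := by
    obtain ⟨e, rfl⟩ := exists_mkE x
    exact inv_pos.2 (Real.sqrt_pos.2 (mul_pos (Nat.cast_pos.2 (G.degree_src_pos e))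
      (Nat.cast_pos.2 (G.degree_tgt_pos e))))

theorem connected_fundamentalGraph (G : PeriodicGraph d V A) : G.fundamentalGraph.Connected := by
  intro x y
  obtain ⟨u, rfl⟩ := exists_mkV x
  obtain ⟨v, rfl⟩ := exists_mkV y
  refine (G.connected u v).lift G.mkV ?_
  rintro _ _ ⟨e, rfl, rfl⟩
  exact ⟨G.mkE e, rfl, rfl⟩

theorem laplacian_sqrt_degree (hd : 0 < d) (v : V) :
    G.laplacian (fun u => (Real.sqrt (G.degree u) : ℂ)) v = 0 := by
  have hv : 0 < (G.degree v : ℝ) := Nat.cast_pos.2 (degree_pos hd v)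
  have hterm (e : A) : (Real.sqrt (G.degree (G.tgt e)) : ℂ) /
      (Real.sqrt ((G.degree v : ℝ) * (G.degree (G.tgt e) : ℝ)) : ℂ) =
      ((Real.sqrt (G.degree v))⁻¹ : ℝ) := by
    have hpos := Real.sqrt_pos.2 (Nat.cast_pos (α := ℝ).2 (G.degree_tgt_pos e))
    rw [Real.sqrt_mul hv.le, ← Complex.ofReal_div, div_mul_cancel_right₀ hpos.ne']
  rw [laplacian, Finset.sum_congr rfl fun e _ => hterm e, Finset.sum_const, nsmul_eq_mul,
    ← Complex.ofReal_natCast, ← Complex.ofReal_mul, ← div_eq_mul_inv, ← degree, Real.div_sqrt,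
    sub_self]

theorem pairing_zero (n : Fin d → ℤ) : pairing n 0 = 0 := by simp [pairing]

theorem pairing_neg (n : Fin d → ℤ) (θ : Fin d → ℝ) : pairing (-n) θ = -pairing n θ := by
  simp [pairing]

theorem pairing_add (m n : Fin d → ℤ) (θ : Fin d → ℝ) :
    pairing (m + n) θ = pairing m θ + pairing n θ := by
  simp [pairing, add_mul, Finset.sum_add_distrib]

theorem pairing_single_one (i : Fin d) (θ : Fin d → ℝ) : pairing (Pi.single i 1) θ = θ i := by
  simp [pairing, Pi.single_apply]

theorem contDiff_pairing (n : Fin d → ℤ) : ContDiff ℝ ω (pairing n) := by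
  unfold pairing
  fun_prop

namespace FundamentalSet

variable (S : G.FundamentalSet)

/-- The gains `e^{i⟨τ(e), θ⟩}` of the fiber operators at quasi-momentum `θ`. -/
def gain (θ : Fin d → ℝ) (e : G.QEdge) : Circle := Circle.exp (pairing (S.qindex e) θ)

theorem gain_zero : S.gain 0 = 1 := by
  ext e
  simp [gain, pairing_zero]

theorem isGain_gain (θ : Fin d → ℝ) : G.fundamentalGraph.IsGain (S.gain θ) := by
  intro x
  obtain ⟨e, rfl⟩ := exists_mkE x
  rw [gain, gain, ← Circle.exp_neg, ← pairing_neg]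
  congr 2
  change S.coord (G.tgt (G.rev e)) - S.coord (G.src (G.rev e)) =
    -(S.coord (G.tgt e) - S.coord (G.src e))
  rw [G.src_rev, ← G.src_rev (G.rev e), G.rev_rev, neg_sub]

theorem gain_add_two_pi_mul (θ : Fin d → ℝ) (n : Fin d → ℤ) :
    S.gain (fun i => θ i + n i * (2 * Real.pi)) = S.gain θ := by
  funext e
  have hpairing : pairing (S.qindex e) (fun i => θ i + n i * (2 * Real.pi)) =
      pairing (S.qindex e) θ + (∑ i, S.qindex e i * n i : ℤ) * (2 * Real.pi) := by
    simp only [pairing, mul_add, Finset.sum_add_distrib, Int.cast_sum, Int.cast_mul,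
      Finset.sum_mul, mul_assoc]
  rw [gain, gain, hpairing, Circle.exp_add, Circle.exp_int_mul_two_pi, mul_one]

/-- The matrix of the fiber operator `H(θ)`, as a Schrödinger operator on `Γ_*` with gains. -/
def fiberMatrix (Q : G.Potential) (θ : Fin d → ℝ) : Matrix G.QVertex G.QVertex ℂ :=
  G.fundamentalGraph.schrodinger (1 + Q.onQuotient) (S.gain θ)

theorem toLin'_fiberMatrix (Q : G.Potential) (θ : Fin d → ℝ) :
    toLin' (S.fiberMatrix Q θ) = S.fiber Q θ := by
  refine LinearMap.ext fun f => funext fun v => ?_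
  have hsum : ∑ e with G.fundamentalGraph.src e = v, (G.fundamentalGraph.weight e *
        S.gain θ e : ℂ) * f (G.fundamentalGraph.tgt e) =
      ∑ e : G.QEdge with G.qsrc e = v, Complex.exp (Complex.I * (pairing (S.qindex e) θ : ℂ)) /
        (Real.sqrt ((G.qdegree v : ℝ) * (G.qdegree (G.qtgt e) : ℝ)) : ℂ) * f (G.qtgt e) := by
    refine Finset.sum_congr rfl fun e he => ?_
    rw [← (Finset.mem_filter.1 he).2]
    simp only [fundamentalGraph, gain, Circle.coe_exp, Complex.ofReal_inv]
    ring_nf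
  rw [toLin'_apply, fiberMatrix, WeightedGraph.schrodinger_mulVec, hsum]
  simp only [fiber, fiberLaplacian, LinearMap.add_apply, Pi.add_apply, LinearMap.coe_mk,
    AddHom.coe_mk, LinearMap.pi_apply, LinearMap.smul_apply, LinearMap.proj_apply, smul_eq_mul,
    Pi.one_apply, Complex.ofReal_add, Complex.ofReal_one]
  ring

theorem isHermitian_fiberMatrix (Q : G.Potential) (θ : Fin d → ℝ) :
    (S.fiberMatrix Q θ).IsHermitian :=
  WeightedGraph.isHermitian_schrodinger _ (S.isGain_gain θ)

theorem fiberMatrix_zero (Q : G.Potential) :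
    S.fiberMatrix Q 0 = G.fundamentalGraph.schrodinger (1 + Q.onQuotient) 1 := by
  rw [fiberMatrix, gain_zero]

theorem eigenvalues_eq_spectrum (Q : G.Potential) (θ : Fin d → ℝ) :
    S.eigenvalues Q θ = spectrum ℝ (S.fiberMatrix Q θ) := by
  ext t
  rw [← spectrum.algebraMap_mem_iff ℂ, ← spectrum_toLin', ← hasEigenvalue_iff_mem_spectrum,
    toLin'_fiberMatrix]
  rfl

theorem lowest_eq_lowestEigenvalue (Q : G.Potential) (θ : Fin d → ℝ) :
    S.lowest Q θ = lowestEigenvalue (S.fiberMatrix Q θ) := by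
  rw [lowest, eigenvalues_eq_spectrum, lowestEigenvalue]

theorem isLeast_lowest (Q : G.Potential) (θ : Fin d → ℝ) :
    IsLeast (S.eigenvalues Q θ) (S.lowest Q θ) := by
  rw [eigenvalues_eq_spectrum, lowest_eq_lowestEigenvalue]
  exact isLeast_lowestEigenvalue (S.isHermitian_fiberMatrix Q θ)

theorem finrank_eigenspace_lowest (Q : G.Potential) :
    Module.finrank ℂ ((S.fiber Q 0).eigenspace (S.lowest Q 0 : ℂ)) = 1 := by
  rw [← toLin'_fiberMatrix, lowest_eq_lowestEigenvalue, fiberMatrix_zero]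
  exact WeightedGraph.finrank_eigenspace_lowestEigenvalue G.connected_fundamentalGraph _

variable {S}

theorem isPositiveGroundState_iff : S.IsPositiveGroundState Q ψ ↔
    G.fundamentalGraph.IsPositiveSolution (1 + Q.onQuotient) (S.lowest Q 0) ψ := by
  have heigen : (S.fiber Q 0) (fun v => (ψ v : ℂ)) = (S.lowest Q 0 : ℂ) • (fun v => (ψ v : ℂ)) ↔
      ∀ v, ∑ e with G.fundamentalGraph.src e = v, G.fundamentalGraph.weight e *
        ψ (G.fundamentalGraph.tgt e) = ((1 + Q.onQuotient) v - S.lowest Q 0) * ψ v := by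
    rw [← WeightedGraph.schrodinger_one_mulVec_eq_iff, ← toLin'_fiberMatrix, fiberMatrix_zero,
      toLin'_apply, Complex.coe_smul]
  constructor
  · rintro ⟨hpos, hψ⟩
    exact ⟨hpos, heigen.1 hψ.apply_eq_smul⟩
  · intro h
    exact ⟨h.pos, mem_eigenspace_iff.2 (heigen.2 h.sum_eq), Function.ne_iff.2
      ⟨Classical.arbitrary _, Complex.ofReal_ne_zero.2 (h.pos _).ne'⟩⟩

variable (S)

theorem exists_isPositiveGroundState (Q : G.Potential) : ∃ ψ, S.IsPositiveGroundState Q ψ := by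
  simp only [isPositiveGroundState_iff, lowest_eq_lowestEigenvalue, fiberMatrix_zero]
  exact WeightedGraph.exists_isPositiveSolution G.connected_fundamentalGraph _

theorem isPositiveGroundState_sqrt_qdegree (hd : 0 < d) :
    S.IsPositiveGroundState (.zero G) fun v => Real.sqrt (G.qdegree v) := by
  have hharmonic : toLin' (S.fiberMatrix (.zero G) 0) (fun v => (Real.sqrt (G.qdegree v) : ℂ)) =
      0 := by
    funext x
    obtain ⟨v, rfl⟩ := exists_mkV x
    have hextend (g : G.QVertex → ℂ) : S.extend 0 g = g ∘ G.mkV := by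
      funext u
      simp [extend, pairing_zero]
    have h := S.schrodinger_extend (.zero G) 0 (fun v => (Real.sqrt (G.qdegree v) : ℂ)) v
    rw [hextend, hextend, Function.comp_apply] at h
    rw [toLin'_fiberMatrix, ← h, schrodinger, Potential.zero, Complex.ofReal_zero, zero_mul,
      add_zero]
    exact laplacian_sqrt_degree hd v
  have hsol : G.fundamentalGraph.IsPositiveSolution (1 + (Potential.zero G).onQuotient) 0
      fun v => Real.sqrt (G.qdegree v) := by
    refine ⟨sqrt_qdegree_pos hd, (WeightedGraph.schrodinger_one_mulVec_eq_iff
      (ψ := fun v => Real.sqrt (G.qdegree v))).1 ?_⟩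
    rw [zero_smul, ← S.fiberMatrix_zero, ← toLin'_apply, hharmonic]
  rw [isPositiveGroundState_iff, lowest_eq_lowestEigenvalue, fiberMatrix_zero,
    hsol.lowestEigenvalue_one]
  exact hsol

theorem IsPositiveGroundState.lowest_zero_le {S : G.FundamentalSet}
    (h : S.IsPositiveGroundState Q ψ) (θ : Fin d → ℝ) : S.lowest Q 0 ≤ S.lowest Q θ := by
  rw [S.lowest_eq_lowestEigenvalue Q θ]
  exact (isPositiveGroundState_iff.1 h).le_lowestEigenvalue (S.isGain_gain θ)

theorem extend_eq (θ : Fin d → ℝ) (g : G.QVertex → ℂ) (v : V) :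
    S.extend θ g v = Circle.exp (pairing (S.coord v) θ) * g (G.mkV v) := by
  rw [extend, Circle.coe_exp, mul_comm Complex.I]

theorem extend_vadd (θ : Fin d → ℝ) (g : G.QVertex → ℂ) (m : Fin d → ℤ) (v : V) :
    S.extend θ g (m +ᵥ v) = Circle.exp (pairing m θ) * S.extend θ g v := by
  rw [extend_eq, extend_eq, S.coord_vadd, pairing_add, Circle.exp_add, Circle.coe_mul, mul_assoc,
    G.mkV_eq.2 ⟨m, rfl⟩]

theorem norm_extend_src_sub_extend_tgt (θ : Fin d → ℝ) (g : G.QVertex → ℂ) (e : A) :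
    ‖S.extend θ g (G.src e) - S.extend θ g (G.tgt e)‖ =
      ‖g (G.mkV (G.src e)) - S.gain θ (G.mkE e) * g (G.mkV (G.tgt e))‖ := by
  have hcoord : S.coord (G.tgt e) = S.coord (G.src e) + S.qindex (G.mkE e) :=
    (add_sub_cancel _ _).symm
  rw [extend_eq, extend_eq, hcoord, pairing_add, Circle.exp_add, Circle.coe_mul, mul_assoc,
    ← mul_sub, norm_mul, Circle.norm_coe, one_mul, gain]

theorem exists_norm_extend_sub_le (hψ : ∀ x, 0 < ψ x) (u v : V) : ∃ C, ∀ θ g,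
    ‖S.extend θ g u - S.extend θ g v‖ ≤
      C * Real.sqrt (G.fundamentalGraph.energy (S.gain θ) ψ g) := by
  induction G.connected u v with
  | refl => exact ⟨0, fun θ g => by simp⟩
  | tail _ hedge ih =>
    obtain ⟨C, hC⟩ := ih
    obtain ⟨e, rfl, rfl⟩ := hedge
    set w := G.fundamentalGraph.weight (G.mkE e) *
      (ψ (G.mkV (G.src e)) * ψ (G.mkV (G.tgt e)))
    have hw : 0 < w := mul_pos (G.fundamentalGraph.weight_pos _) (mul_pos (hψ _) (hψ _))
    refine ⟨C + Real.sqrt (2 / w), fun θ g => (norm_sub_le_norm_sub_add_norm_sub _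
      (S.extend θ g (G.src e)) _).trans ?_⟩
    rw [add_mul]
    refine add_le_add (hC θ g) ?_
    rw [norm_extend_src_sub_extend_tgt, ← Real.sqrt_mul (by positivity)]
    refine Real.le_sqrt_of_sq_le ?_
    rw [div_mul_eq_mul_div, le_div_iff₀' hw]
    exact G.fundamentalGraph.mul_norm_sub_sq_le_energy (fun x => (hψ x).le) (S.gain θ) g (G.mkE e)

theorem two_mul_one_sub_cos_mul_norm_sq_le {C : ℝ} {m : Fin d → ℤ} {θ : Fin d → ℝ}
    {g : G.QVertex → ℂ} {x : G.QVertex} (h : ‖S.extend θ g (m +ᵥ S.rep x) -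
      S.extend θ g (S.rep x)‖ ≤ C * Real.sqrt (G.fundamentalGraph.energy (S.gain θ) ψ g))
    (hψ : ∀ x, 0 ≤ ψ x) : 2 * (1 - Real.cos (pairing m θ)) * ‖g x‖ ^ 2 ≤
      C ^ 2 * G.fundamentalGraph.energy (S.gain θ) ψ g := by
  have hrep : ‖S.extend θ g (S.rep x)‖ = ‖g x‖ := by
    rw [extend_eq, norm_mul, Circle.norm_coe, one_mul, S.mkV_rep]
  have hphase : ‖(Circle.exp (pairing m θ) : ℂ) - 1‖ ^ 2 = 2 * (1 - Real.cos (pairing m θ)) := by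
    rw [Complex.norm_sub_one_sq_eq_of_norm_eq_one (Circle.norm_coe _), Circle.coe_exp,
      Complex.exp_ofReal_mul_I_re]
  have hsq := pow_le_pow_left₀ (norm_nonneg _) h 2
  rwa [extend_vadd, ← sub_one_mul, norm_mul, hrep, mul_pow, hphase, mul_pow,
    Real.sq_sqrt (G.fundamentalGraph.energy_nonneg hψ _ g)] at hsq

/-- Along a path from `v` to `v + m`, the Floquet extension of `g` varies by at most a multiple of
the square root of the energy, while its value is multiplied by `e^{i⟨m, θ⟩}`. -/
theorem exists_one_sub_cos_mul_le_energy (hψ : ∀ x, 0 < ψ x) (m : Fin d → ℤ) :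
    ∃ c > 0, ∀ θ g, c * (1 - Real.cos (pairing m θ)) * ∑ x, ‖ψ x • g x‖ ^ 2 ≤
      G.fundamentalGraph.energy (S.gain θ) ψ g := by
  choose C hC using fun x => S.exists_norm_extend_sub_le hψ (m +ᵥ S.rep x) (S.rep x)
  set K := ∑ x, ψ x ^ 2 * C x ^ 2 with hK_def
  have : 0 ≤ K := by positivity
  refine ⟨2 / (K + 1), by positivity, fun θ g => ?_⟩
  have henergy := G.fundamentalGraph.energy_nonneg (fun x => (hψ x).le) (S.gain θ) g
  have hsum : 2 * (1 - Real.cos (pairing m θ)) * ∑ x, ‖ψ x • g x‖ ^ 2 ≤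
      K * G.fundamentalGraph.energy (S.gain θ) ψ g := by
    rw [hK_def, Finset.mul_sum, Finset.sum_mul]
    refine Finset.sum_le_sum fun x _ => ?_
    have := mul_le_mul_of_nonneg_left
      (S.two_mul_one_sub_cos_mul_norm_sq_le (hC x θ g) fun x => (hψ x).le) (sq_nonneg (ψ x))
    rw [norm_smul_of_nonneg (hψ x).le]
    linarith
  rw [div_mul_eq_mul_div, div_mul_eq_mul_div, div_le_iff₀' (by positivity)]
  linarith

theorem exists_mul_one_sub_cos_le (Q : G.Potential) (m : Fin d → ℤ) : ∃ c > 0, ∀ θ,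
    c * (1 - Real.cos (pairing m θ)) ≤ S.lowest Q θ - S.lowest Q 0 := by
  obtain ⟨ψ, hψ⟩ := S.exists_isPositiveGroundState Q
  have hsol := isPositiveGroundState_iff.1 hψ
  obtain ⟨c, hc, hle⟩ := S.exists_one_sub_cos_mul_le_energy hψ.1 m
  refine ⟨c, hc, fun θ => ?_⟩
  obtain ⟨g, hg, heq⟩ := hsol.exists_energy_eq (S.isGain_gain θ)
  refine le_of_mul_le_mul_right ?_ (sum_norm_smul_sq_pos (fun x => (hψ.1 x).ne') hg)
  rw [S.lowest_eq_lowestEigenvalue Q θ, fiberMatrix, ← heq]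
  exact hle θ g

theorem contDiff_fiberMatrix (Q : G.Potential) (x y : G.QVertex) :
    ContDiff ℝ ω fun θ => S.fiberMatrix Q θ x y := by
  simp only [fiberMatrix, WeightedGraph.schrodinger, Matrix.sub_apply, Matrix.sum_apply,
    single_apply, gain, Circle.coe_exp]
  refine contDiff_const.sub (ContDiff.sum fun e _ => ?_)
  have := Complex.ofRealCLM.contDiff.comp (contDiff_pairing (S.qindex e))
  split_ifs
  · exact contDiff_const.mul (this.mul contDiff_const).cexp
  · exact contDiff_const

theorem continuous_lowest (Q : G.Potential) : Continuous (S.lowest Q) := by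
  simp only [funext (S.lowest_eq_lowestEigenvalue Q)]
  exact continuous_lowestEigenvalue (S.isHermitian_fiberMatrix Q)
    (continuous_matrix fun x y => (S.contDiff_fiberMatrix Q x y).continuous)

theorem contDiffAt_lowest (Q : G.Potential) : ContDiffAt ℝ ω (S.lowest Q) 0 := by
  have hsimple := S.finrank_eigenspace_lowest Q
  rw [← toLin'_fiberMatrix, lowest_eq_lowestEigenvalue] at hsimple
  simp only [funext (S.lowest_eq_lowestEigenvalue Q)]
  exact contDiffAt_lowestEigenvalue (by simp) (S.isHermitian_fiberMatrix Q)
    (S.contDiff_fiberMatrix Q) hsimple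

theorem firstBand_eq_image (Q : G.Potential) :
    S.firstBand Q = S.lowest Q '' Set.Icc 0 fun _ => 2 * Real.pi := by
  refine Set.Subset.antisymm ?_ (Set.image_subset_range _ _)
  rintro _ ⟨θ, rfl⟩
  refine ⟨fun i => θ i + (-⌊θ i / (2 * Real.pi)⌋ : ℤ) * (2 * Real.pi), ⟨fun i => ?_, fun i => ?_⟩,
    ?_⟩
  · have := (le_div_iff₀ Real.two_pi_pos).1 (Int.floor_le (θ i / (2 * Real.pi)))
    rw [Pi.zero_apply]
    push_cast
    linarith
  · have := (div_lt_iff₀ Real.two_pi_pos).1 (Int.lt_floor_add_one (θ i / (2 * Real.pi)))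
    push_cast
    linarith
  · simp only [lowest_eq_lowestEigenvalue, fiberMatrix]
    rw [S.gain_add_two_pi_mul θ fun i => -⌊θ i / (2 * Real.pi)⌋]

variable {S}

theorem IsPositiveGroundState.exists_firstBand_eq_Icc (h : S.IsPositiveGroundState Q ψ) :
    ∃ θ, S.firstBand Q = Set.Icc (S.lowest Q 0) (S.lowest Q θ) := by
  have hcompact : IsCompact (S.firstBand Q) := by
    rw [firstBand_eq_image]
    exact isCompact_Icc.image (S.continuous_lowest Q)
  obtain ⟨_, ⟨θ, rfl⟩, hmax⟩ := hcompact.exists_isGreatest ⟨_, 0, rfl⟩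
  refine ⟨θ, Set.Subset.antisymm ?_ ?_⟩
  · rintro _ ⟨η, rfl⟩
    exact ⟨h.lowest_zero_le η, hmax ⟨η, rfl⟩⟩
  · exact (isPreconnected_range (S.continuous_lowest Q)).Icc_subset ⟨0, rfl⟩ ⟨θ, rfl⟩

theorem IsPositiveGroundState.exists_lt_firstBand_eq_Icc (hd : 0 < d)
    (h : S.IsPositiveGroundState Q ψ) : ∃ a b, a < b ∧ S.firstBand Q = Set.Icc a b := by
  obtain ⟨θ, hθ⟩ := h.exists_firstBand_eq_Icc
  obtain ⟨c, hc, hle⟩ := S.exists_mul_one_sub_cos_le Q (Pi.single ⟨0, hd⟩ 1)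
  have hpi := hle fun _ => Real.pi
  rw [pairing_single_one, Real.cos_pi] at hpi
  have hmax : S.lowest Q (fun _ => Real.pi) ≤ S.lowest Q θ :=
    (hθ.subset ⟨fun _ => Real.pi, rfl⟩).2
  exact ⟨_, _, by linarith, hθ⟩

theorem IsPositiveGroundState.firstBandLength_le {P : G.Potential} {φ : G.QVertex → ℝ}
    (hφ : S.IsPositiveGroundState P φ) (hψ : S.IsPositiveGroundState Q ψ) {C : ℝ} (hC : 0 ≤ C)
    (h : ∀ θ, S.lowest Q θ - S.lowest Q 0 ≤ C * (S.lowest P θ - S.lowest P 0)) :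
    S.firstBandLength Q ≤ C * S.firstBandLength P := by
  obtain ⟨θ, hθ⟩ := hψ.exists_firstBand_eq_Icc
  obtain ⟨η, hη⟩ := hφ.exists_firstBand_eq_Icc
  rw [firstBandLength, firstBandLength, hθ, hη, Real.volume_real_Icc_of_le (hψ.lowest_zero_le θ),
    Real.volume_real_Icc_of_le (hφ.lowest_zero_le η)]
  have hmax : S.lowest P θ ≤ S.lowest P η := (hη.subset ⟨θ, rfl⟩).2
  exact (h θ).trans (mul_le_mul_of_nonneg_left (sub_le_sub_right hmax _) hC)

theorem posSemidef_smul_massHessian_sub {P : G.Potential} {C : ℝ}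
    (h : ∀ θ, S.lowest Q θ - S.lowest Q 0 ≤ C * (S.lowest P θ - S.lowest P 0)) :
    (C • S.massHessian P - S.massHessian Q).PosSemidef :=
  posSemidef_smul_hessianMatrix_sub ((S.contDiffAt_lowest P).of_le le_top)
    ((S.contDiffAt_lowest Q).of_le le_top) h

theorem posDef_massHessian (S : G.FundamentalSet) (Q : G.Potential) : (S.massHessian Q).PosDef := by
  refine posDef_hessianMatrix_of_one_sub_cos_le ((S.contDiffAt_lowest Q).of_le le_top) fun i => ?_
  simpa only [pairing_single_one] using S.exists_mul_one_sub_cos_le Q (Pi.single i 1)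

theorem posSemidef_smul_effectiveMass_sub {P : G.Potential} {C : ℝ} (hC : 0 < C)
    (h : ∀ θ, S.lowest Q θ - S.lowest Q 0 ≤ C * (S.lowest P θ - S.lowest P 0)) :
    (C • S.effectiveMass Q - S.effectiveMass P).PosSemidef :=
  posSemidef_smul_inv_sub_inv (S.posDef_massHessian Q) (S.posDef_massHessian P) hC
    (posSemidef_smul_massHessian_sub h)

end FundamentalSet

theorem psiMinus_mul_sqrt_le (hd : 0 < d) (ψ : G.QVertex → ℝ) (x : G.QVertex) :
    G.psiMinus ψ * Real.sqrt (G.qdegree x) ≤ ψ x :=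
  (le_div_iff₀ (sqrt_qdegree_pos hd x)).1 (ciInf_le (Set.finite_range _).bddBelow x)

theorem le_psiPlus_mul_sqrt (hd : 0 < d) (ψ : G.QVertex → ℝ) (x : G.QVertex) :
    ψ x ≤ G.psiPlus ψ * Real.sqrt (G.qdegree x) :=
  (div_le_iff₀ (sqrt_qdegree_pos hd x)).1 (le_ciSup
    (f := fun x => ψ x / Real.sqrt (G.qdegree x)) (Set.finite_range _).bddAbove x)

theorem psiMinus_pos (hd : 0 < d) (hψ : ∀ x, 0 < ψ x) : 0 < G.psiMinus ψ := by
  obtain ⟨x, hx⟩ := exists_eq_ciInf_of_finite (f := fun x => ψ x / Real.sqrt (G.qdegree x))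
  rw [psiMinus, ← hx]
  exact div_pos (hψ x) (sqrt_qdegree_pos hd x)

theorem psiPlus_pos (hd : 0 < d) (hψ : ∀ x, 0 < ψ x) : 0 < G.psiPlus ψ :=
  pos_of_mul_pos_left ((hψ (Classical.arbitrary _)).trans_le (le_psiPlus_mul_sqrt hd ψ _))
    (Real.sqrt_nonneg _)

theorem cZero_pos (hd : 0 < d) (hψ : ∀ x, 0 < ψ x) : 0 < G.cZero ψ :=
  div_pos (psiPlus_pos hd hψ) (psiMinus_pos hd hψ)

namespace FundamentalSet.IsPositiveGroundState

variable {S : G.FundamentalSet}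

theorem lowest_sub_le_cZero_sq_mul (hd : 0 < d) (h : S.IsPositiveGroundState Q ψ)
    (θ : Fin d → ℝ) : S.lowest Q θ - S.lowest Q 0 ≤
      G.cZero ψ ^ 2 * (S.lowest (.zero G) θ - S.lowest (.zero G) 0) := by
  rw [S.lowest_eq_lowestEigenvalue Q θ, S.lowest_eq_lowestEigenvalue (.zero G) θ]
  exact (isPositiveGroundState_iff.1
    (S.isPositiveGroundState_sqrt_qdegree hd)).lowestEigenvalue_sub_le_mul
    (isPositiveGroundState_iff.1 h) (S.isGain_gain θ) (psiMinus_pos hd h.1)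
    (psiMinus_mul_sqrt_le hd ψ) (le_psiPlus_mul_sqrt hd ψ)

theorem lowest_zero_sub_le_cZero_sq_mul (hd : 0 < d) (h : S.IsPositiveGroundState Q ψ)
    (θ : Fin d → ℝ) : S.lowest (.zero G) θ - S.lowest (.zero G) 0 ≤
      G.cZero ψ ^ 2 * (S.lowest Q θ - S.lowest Q 0) := by
  have hplus := psiPlus_pos hd h.1
  have hminus := psiMinus_pos hd h.1
  rw [S.lowest_eq_lowestEigenvalue Q θ, S.lowest_eq_lowestEigenvalue (.zero G) θ, cZero,
    ← inv_div_inv]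
  exact (isPositiveGroundState_iff.1 h).lowestEigenvalue_sub_le_mul
    (isPositiveGroundState_iff.1 (S.isPositiveGroundState_sqrt_qdegree hd)) (S.isGain_gain θ)
    (inv_pos.2 hplus) (fun x => (inv_mul_le_iff₀ hplus).2 (le_psiPlus_mul_sqrt hd ψ x))
    (fun x => (le_inv_mul_iff₀ hminus).2 (psiMinus_mul_sqrt_le hd ψ x))

theorem firstBandLength_bounds (hd : 0 < d) (h : S.IsPositiveGroundState Q ψ) :
    (G.cZero ψ ^ 2)⁻¹ * S.firstBandLength (.zero G) ≤ S.firstBandLength Q ∧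
      S.firstBandLength Q ≤ G.cZero ψ ^ 2 * S.firstBandLength (.zero G) := by
  have hzero := S.isPositiveGroundState_sqrt_qdegree hd
  have hc := pow_pos (cZero_pos hd h.1) 2
  exact ⟨(inv_mul_le_iff₀ hc).2
      (h.firstBandLength_le hzero hc.le (h.lowest_zero_sub_le_cZero_sq_mul hd)),
    hzero.firstBandLength_le h hc.le (h.lowest_sub_le_cZero_sq_mul hd)⟩

theorem effectiveMass_bounds (hd : 0 < d) (h : S.IsPositiveGroundState Q ψ) :
    (S.effectiveMass Q - (G.cZero ψ ^ 2)⁻¹ • S.effectiveMass (.zero G)).PosSemidef ∧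
      (G.cZero ψ ^ 2 • S.effectiveMass (.zero G) - S.effectiveMass Q).PosSemidef := by
  have hc := pow_pos (cZero_pos hd h.1) 2
  refine ⟨?_, posSemidef_smul_effectiveMass_sub hc (h.lowest_zero_sub_le_cZero_sq_mul hd)⟩
  have hlower := (posSemidef_smul_effectiveMass_sub hc (h.lowest_sub_le_cZero_sq_mul hd)).smul
    (inv_pos.2 hc).le
  rwa [smul_sub, inv_smul_smul₀ hc.ne'] at hlower

end FundamentalSet.IsPositiveGroundState

end PeriodicGraph

end PeriodicGraph

end

open scoped ContDiff in
theorem theorem2p1_general {d : ℕ} (hd : 0 < d) {V A : Type*}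
    [AddAction (Fin d → ℤ) V] [AddAction (Fin d → ℤ) A]
    (G : PeriodicGraph d V A) (S : G.FundamentalSet) (Q : G.Potential) :
    (IsLeast (S.eigenvalues Q 0) (S.lowest Q 0) ∧
      Module.finrank ℂ ((S.fiber Q 0).eigenspace (S.lowest Q 0 : ℂ)) = 1 ∧
      ∃ ψ, S.IsPositiveGroundState Q ψ) ∧
    ((∃ a b : ℝ, a < b ∧ S.firstBand Q = Set.Icc a b) ∧
      ∀ ψ, S.IsPositiveGroundState Q ψ →
        (G.cZero ψ ^ 2)⁻¹ * S.firstBandLength (.zero G) ≤ S.firstBandLength Q ∧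
        S.firstBandLength Q ≤ G.cZero ψ ^ 2 * S.firstBandLength (.zero G)) ∧
    ((∀ P ∈ ({Q, .zero G} : Set G.Potential),
        ContDiffAt ℝ ω (S.lowest P) 0 ∧ IsUnit (S.massHessian P).det) ∧
      ∀ ψ, S.IsPositiveGroundState Q ψ →
        (S.effectiveMass Q - (G.cZero ψ ^ 2)⁻¹ • S.effectiveMass (.zero G)).PosSemidef ∧
        (G.cZero ψ ^ 2 • S.effectiveMass (.zero G) - S.effectiveMass Q).PosSemidef) := by
  obtain ⟨ψ, hψ⟩ := S.exists_isPositiveGroundState Q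
  exact ⟨⟨S.isLeast_lowest Q 0, S.finrank_eigenspace_lowest Q, ψ, hψ⟩,
    ⟨hψ.exists_lt_firstBand_eq_Icc hd, fun _ h => h.firstBandLength_bounds hd⟩,
    fun P _ => ⟨S.contDiffAt_lowest P, (S.posDef_massHessian P).det_pos.ne'.isUnit⟩,
    fun _ h => h.effectiveMass_bounds hd⟩

theorem theorem2p1 {d : ℕ} (hd : 2 ≤ d) {V A : Type*}
    [AddAction (Fin d → ℤ) V] [AddAction (Fin d → ℤ) A]
    (G : PeriodicGraph d V A) (S : G.FundamentalSet) (Q : G.Potential) :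
    -- i) the lowest eigenvalue of `H(0)` is simple and has a positive eigenvector
    (IsLeast (S.eigenvalues Q 0) (S.lowest Q 0) ∧
      Module.finrank ℂ ((S.fiber Q 0).eigenspace (S.lowest Q 0 : ℂ)) = 1 ∧
      ∃ ψ, S.IsPositiveGroundState Q ψ) ∧
    -- ii) the first band is a non-degenerate closed interval, with a two-sided length estimate
    ((∃ a b : ℝ, a < b ∧ S.firstBand Q = Set.Icc a b) ∧
      ∀ ψ, S.IsPositiveGroundState Q ψ →
        (G.cZero ψ ^ 2)⁻¹ * S.firstBandLength (.zero G) ≤ S.firstBandLength Q ∧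
        S.firstBandLength Q ≤ G.cZero ψ ^ 2 * S.firstBandLength (.zero G)) ∧
    -- iii) the effective mass tensors of `H` and `Δ` exist, with a two-sided estimate
    ((∀ P ∈ ({Q, .zero G} : Set G.Potential),
        ContDiffAt ℝ 3 (S.lowest P) 0 ∧ IsUnit (S.massHessian P).det) ∧
      ∀ ψ, S.IsPositiveGroundState Q ψ →
        (S.effectiveMass Q - (G.cZero ψ ^ 2)⁻¹ • S.effectiveMass (.zero G)).PosSemidef ∧
        (G.cZero ψ ^ 2 • S.effectiveMass (.zero G) - S.effectiveMass Q).PosSemidef) := by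
  obtain ⟨hground, hband, hregular, hmass⟩ := theorem2p1_general (by omega : 0 < d) G S Q
  exact ⟨hground, hband, fun P hP => (hregular P hP).imp_left (·.of_le le_top), hmass⟩
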